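/- Let $\sigma>\rho\ge 0$, $s\in(0,1)$, $\tau\in[1,\infty)$ and $p,q\in[1,\infty]$ with $1\le\tau\le q\le p$. There is a constant $C$, depending only on $s,\tau,q,p,\sigma$ and $\rho$, such that the following holds for all $n\ge 2$ and $N\ge 1$. Write $B_r=B_r(0)\subset\mathbb R^n$ for the open ball of radius $r$ about $0$, with $B_0=\emptyset$; function spaces over $B_\sigma\setminus B_\rho$ are understood over its interior. For $M=B_\sigma\setminus B_\rho$ or $M=\partial B_r$, let $L^p(M)=L^p(M,\mathbb R^N)$ (with Lebesgue measure or surface measure, respectively) and let $W^{1,p}(M)=W^{1,p}(M,\mathbb R^N)$ be the Sobolev space of those $u\in L^p(M)$ whose weak gradient $\mathrm D u$ (weak tangential gradient if $M=\partial B_r$) is in $L^p(M)$, with norm $\|u\|_{W^{1,p}(M)}=\|u\|_{L^p(M)}+\|\mathrm D u\|_{L^p(M)}$, matrices carrying the Euclidean norm. The Besov space $B^{s,p}_q(M)$ is the real interpolation space between $L^p(M)$ and $W^{1,p}(M)$ that consists of the $v\in L^p(M)$ with $$\|v\|_{B^{s,p}_q(M)}=\left(\int_0^\infty\bigl(t^{-s}K(v,t)\bigr)^q\,\frac{\mathrm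 dt}{t}\right)^{1/q}<\infty,$$ $$K(v,t)=\inf\bigl\{\|v_1\|_{L^p(M)}+t\,\|v_2\|_{W^{1,p}(M)}:\ v=v_1+v_2,\ v_1\in L^p(M),\ v_2\in W^{1,p}(M)\bigr\},$$ where for $q=\infty$ the integral expression is replaced by $\sup_{t>0}t^{-s}K(v,t)$. If $v\in B^{s,p}_q(B_\sigma\setminus B_\rho)$, then $r\mapsto\|v\|_{B^{s,p}_q(\partial B_r)}$ is Lebesgue measurable on $(\rho,\sigma)$, and $$\int_\rho^\sigma\|v\|_{B^{s,p}_q(\partial B_r)}^\tau\,\mathrm dr\le C\,\|v\|_{B^{s,p}_q(B_\sigma\setminus B_\rho)}^\tau.$$ -/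

import Mathlib

open MeasureTheory Set
open scoped ENNReal NNReal ContDiff

noncomputable section

/-- The values of a gradient of a map `ℝⁿ → ℝᴺ`: the `i`-th entry is the `i`-th partial derivative,
a vector of `ℝᴺ`. The norm of this space is the Euclidean (Frobenius) norm of the matrix. -/
abbrev GradSpace (n N : ℕ) : Type :=
  PiLp 2 (fun _ : Fin n => EuclideanSpace ℝ (Fin N))

/-- `w` is a weak (distributional) gradient of `u` on the open set `Ω`:
`∫_Ω u ∂ᵢφ = - ∫_Ω φ wᵢ` for every `i` and every `φ ∈ C_c^∞(Ω)`.
It is used only for `u` and `w` of class `L^p(Ω)`, `1 ≤ p`, where all integrals converge. -/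
def IsWeakGradient {n N : ℕ} (Ω : Set (EuclideanSpace ℝ (Fin n)))
    (u : EuclideanSpace ℝ (Fin n) → EuclideanSpace ℝ (Fin N))
    (w : EuclideanSpace ℝ (Fin n) → GradSpace n N) : Prop :=
  ∀ φ : EuclideanSpace ℝ (Fin n) → ℝ, ContDiff ℝ ∞ φ → HasCompactSupport φ → tsupport φ ⊆ Ω →
    ∀ i : Fin n,
      ∫ x in Ω, (fderiv ℝ φ x (EuclideanSpace.single i 1)) • u x = - ∫ x in Ω, φ x • w x i

/-- The surface measure of the sphere `∂B_r` of `ℝⁿ` centred at `0`, as a measure on `ℝⁿ`: the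
image of `r ^ (n - 1)` times the surface measure of the unit sphere under `ω ↦ r ω`
(for `r > 0` and `n ≥ 1`). -/
def sphereMeasure (n : ℕ) (r : ℝ) : Measure (EuclideanSpace ℝ (Fin n)) :=
  ENNReal.ofReal (r ^ (n - 1)) •
    Measure.map
      (fun y : Metric.sphere (0 : EuclideanSpace ℝ (Fin n)) 1 =>
        r • (y : EuclideanSpace ℝ (Fin n)))
      (volume : Measure (EuclideanSpace ℝ (Fin n))).toSphere

/-- `w` is a weak tangential gradient of `u` on the sphere `∂B_r`: it is tangential, and
`∫_{∂B_r} u div X = - ∫_{∂B_r} X · w` for every smooth tangential vector field `X`.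
A smooth tangential vector field on `∂B_r` is the restriction of a smooth field `X` on `ℝⁿ` with
`X x ⟂ x` for all `x`. For such a field the derivative of `X` in the radial direction is orthogonal
to the radial direction, so the surface divergence is the full divergence `∑ᵢ ∂ᵢ Xᵢ`. -/
def IsWeakTangentialGradient {n N : ℕ} (r : ℝ)
    (u : EuclideanSpace ℝ (Fin n) → EuclideanSpace ℝ (Fin N))
    (w : EuclideanSpace ℝ (Fin n) → GradSpace n N) : Prop :=
  (∀ᵐ x ∂(sphereMeasure n r), ∑ i, x i • w x i = 0) ∧
  ∀ X : EuclideanSpace ℝ (Fin n) → EuclideanSpace ℝ (Fin n), ContDiff ℝ ∞ X →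
    (∀ x, inner ℝ (X x) x = 0) →
      ∫ x, (∑ i, (fderiv ℝ X x (EuclideanSpace.single i 1)) i) • u x ∂(sphereMeasure n r)
        = - ∫ x, ∑ i, X x i • w x i ∂(sphereMeasure n r)

/-- The `W^{1,p}` norm `‖u‖_{L^p(μ)} + ‖w‖_{L^p(μ)}`, where `w` is the gradient of `u`.
Here `μ` is the underlying measure and `D u w` says that `w` is a weak gradient of `u` (the gradient
is unique up to `μ`-null sets). The value is `∞` when `u` is not in `W^{1,p}`. -/
def sobolevENorm {n N : ℕ} (μ : Measure (EuclideanSpace ℝ (Fin n)))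
    (D : (EuclideanSpace ℝ (Fin n) → EuclideanSpace ℝ (Fin N)) →
      (EuclideanSpace ℝ (Fin n) → GradSpace n N) → Prop)
    (p : ℝ≥0∞) (u : EuclideanSpace ℝ (Fin n) → EuclideanSpace ℝ (Fin N)) : ℝ≥0∞ :=
  ⨅ (w : EuclideanSpace ℝ (Fin n) → GradSpace n N)
    (_ : MemLp u p μ ∧ MemLp w p μ ∧ D u w), eLpNorm u p μ + eLpNorm w p μ

/-- Peetre's functional of the couple `(L^p, W^{1,p})`: the infimum of
`‖v₁‖_{L^p} + t ‖v₂‖_{W^{1,p}}` over all decompositions `v = v₁ + v₂` with `v₁ ∈ L^p` and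
`v₂ ∈ W^{1,p}`. -/
def kFunctional {n N : ℕ} (μ : Measure (EuclideanSpace ℝ (Fin n)))
    (D : (EuclideanSpace ℝ (Fin n) → EuclideanSpace ℝ (Fin N)) →
      (EuclideanSpace ℝ (Fin n) → GradSpace n N) → Prop)
    (p : ℝ≥0∞) (v : EuclideanSpace ℝ (Fin n) → EuclideanSpace ℝ (Fin N)) (t : ℝ) : ℝ≥0∞ :=
  ⨅ (v₁ : EuclideanSpace ℝ (Fin n) → EuclideanSpace ℝ (Fin N))
    (v₂ : EuclideanSpace ℝ (Fin n) → EuclideanSpace ℝ (Fin N))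
    (_ : MemLp v₁ p μ ∧ v =ᵐ[μ] v₁ + v₂),
    eLpNorm v₁ p μ + ENNReal.ofReal t * sobolevENorm μ D p v₂

/-- The norm of the real interpolation space `(L^p, W^{1,p})_{s,q}`: the norm of
`t ↦ t ^ (-s) K(v, t)` in `L^q((0, ∞), dt / t)`. -/
def interpolationENorm {n N : ℕ} (μ : Measure (EuclideanSpace ℝ (Fin n)))
    (D : (EuclideanSpace ℝ (Fin n) → EuclideanSpace ℝ (Fin N)) →
      (EuclideanSpace ℝ (Fin n) → GradSpace n N) → Prop)
    (s : ℝ) (p q : ℝ≥0∞) (v : EuclideanSpace ℝ (Fin n) → EuclideanSpace ℝ (Fin N)) : ℝ≥0∞ :=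
  eLpNorm (fun t : ℝ => ENNReal.ofReal (t ^ (-s)) * kFunctional μ D p v t) q
    ((volume.restrict (Ioi (0 : ℝ))).withDensity (fun t => ENNReal.ofReal t⁻¹))

/-- The norm of `B^{s,p}_q(Ω, ℝᴺ)` for an open set `Ω` of `ℝⁿ`. -/
def besovENorm {n N : ℕ} (Ω : Set (EuclideanSpace ℝ (Fin n))) (s : ℝ) (p q : ℝ≥0∞)
    (v : EuclideanSpace ℝ (Fin n) → EuclideanSpace ℝ (Fin N)) : ℝ≥0∞ :=
  interpolationENorm (volume.restrict Ω) (IsWeakGradient Ω) s p q v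

/-- `v ∈ B^{s,p}_q(Ω, ℝᴺ)`. -/
def MemBesov {n N : ℕ} (Ω : Set (EuclideanSpace ℝ (Fin n))) (s : ℝ) (p q : ℝ≥0∞)
    (v : EuclideanSpace ℝ (Fin n) → EuclideanSpace ℝ (Fin N)) : Prop :=
  MemLp v p (volume.restrict Ω) ∧ besovENorm Ω s p q v < ⊤

/-- The norm of `B^{s,p}_q(∂B_r, ℝᴺ)`, where `∂B_r` is the sphere of radius `r` centred at `0`. -/
def besovSphereENorm {n N : ℕ} (r : ℝ) (s : ℝ) (p q : ℝ≥0∞)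
    (v : EuclideanSpace ℝ (Fin n) → EuclideanSpace ℝ (Fin N)) : ℝ≥0∞ :=
  interpolationENorm (sphereMeasure n r) (IsWeakTangentialGradient r) s p q v

/-- The annulus `B_σ \ B_ρ` centred at `0`, as an open set: `{ρ < |x| < σ}` if `ρ > 0`, and the
ball `B_σ` if `ρ = 0`. -/
def annulus (n : ℕ) (ρ σ : ℝ) : Set (EuclideanSpace ℝ (Fin n)) :=
  interior (Metric.ball 0 σ \ Metric.ball 0 ρ)

end

/-! Fix `t > 0` and split `v = v₁ + v₂` on the annulus, with `g` a weak gradient of `v₂`. On almost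
every sphere `∂B_r` the restriction of `v₂` has the tangential part of `g` as weak tangential
gradient, so `K_r(v, t)`, the K-functional of `∂B_r`, is at most the cost of the restricted
splitting. Polar coordinates and the triangle inequality in `L^p(dr)` give `‖K_r(v, t)‖_{L^p(dr)} ≤
K(v, t)` (`eLpNorm_kFunctional_sphere_le`). Hölder on `(ρ, σ)` replaces `L^p(dr)` by `L^q(dr)`,
Tonelli exchanges it with `L^q(dt/t)`, and Hölder once more passes from `q` to `τ`. The constant is
a power of `σ - ρ`.

Slicing of weak gradients: testing with `η(|x|) X` for a tangential field `X` never differentiates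
`η`, because the gradient of `η(|x|)` is radial. Since `η` is arbitrary, the integration by parts
formula for `X` holds on almost every sphere. A countable family of fields, dense in `C¹`, makes the
null set of radii independent of `X`.

Tonelli needs `K_r(v, t)` to be jointly measurable in `(r, t)`, although it is an infimum over
uncountably many splittings. Rescaling to the unit sphere makes the competitors independent of `r`.
Grouping them by rational bounds on the norms of the map and of its gradient leaves a countable
infimum of distances from `v(r ·)` to fixed Sobolev balls. For `p < ∞` separability of `L^p` makes
such a distance a countable infimum of measurable functions. For `p = ∞` separability fails.
Instead, the maps within uniform distance `x` of a Sobolev ball form a closed set in `L²`, being the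
image of a bounded closed convex subset of a Hilbert space under a continuous linear map; membership
is then vanishing of an `L²` distance, which is measurable. -/

section IteratedNorms

/-! ### Iterated `L^p` norms: measurability and exchange. -/

variable {α β ε : Type*} [MeasurableSpace α] [MeasurableSpace β]

/-- For `p = ∞`, an essential supremum is at most `c` exactly when a section of a measurable
superlevel set is null, and the measure of sections is measurable. -/
theorem measurable_eLpNorm_of_measurable_enorm [ENorm ε] {f : α → β → ε} (p : ℝ≥0∞)
    (ν : Measure β) [SFinite ν] (hf : Measurable fun z : α × β => ‖f z.1 z.2‖ₑ) :
    Measurable fun a => eLpNorm (f a) p ν := by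
  by_cases h0 : p = 0
  · simp [h0]
  by_cases ht : p = ⊤
  · simp only [ht, eLpNorm_exponent_top]
    refine measurable_of_Iic fun c => ?_
    have : (fun a => eLpNormEssSup (f a) ν) ⁻¹' Iic c
        = {a | ν (Prod.mk a ⁻¹' {z : α × β | c < ‖f z.1 z.2‖ₑ}) = 0} := by
      ext a
      simp only [mem_preimage, mem_Iic, mem_ofPred_eq]
      constructor
      · intro h
        have h1 := enorm_ae_le_eLpNormEssSup (f a) ν
        have h2 : ∀ᵐ y ∂ν, ¬ c < ‖f a y‖ₑ := by
          filter_upwards [h1] with y hy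
          exact not_lt.2 (hy.trans h)
        rw [ae_iff] at h2
        simpa using h2
      · intro h
        refine essSup_le_of_ae_le _ ?_
        change ∀ᵐ y ∂ν, ‖f a y‖ₑ ≤ c
        rw [ae_iff]
        simpa using h
    rw [this]
    exact measurable_measure_prodMk_left (measurableSet_lt measurable_const hf)
      (measurableSet_singleton 0)
  · simp only [eLpNorm_eq_lintegral_rpow_enorm_toReal h0 ht]
    exact (Measurable.lintegral_prod_right' (hf.pow_const _)).pow_const _

/-- Tonelli for `p < ∞`; for `p = ∞`, the a.e. quantifiers over the two factors commute on
measurable sets. -/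
theorem eLpNorm_eLpNorm_swap_le {f : α → β → ℝ≥0∞} {p : ℝ≥0∞} (h0 : p ≠ 0)
    (μ : Measure α) [SFinite μ] (ν : Measure β) [SFinite ν]
    (hf : Measurable fun z : α × β => f z.1 z.2) :
    eLpNorm (fun a => eLpNorm (f a) p ν) p μ ≤ eLpNorm (fun b => eLpNorm (fun a => f a b) p μ) p ν := by
  by_cases ht : p = ⊤
  · subst ht
    simp only [eLpNorm_exponent_top]
    refine essSup_le_of_ae_le _ ?_
    change ∀ᵐ a ∂μ, eLpNormEssSup (f a) ν ≤ _
    set M := eLpNormEssSup (fun b => eLpNormEssSup (fun a => f a b) μ) ν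
    have h1 : ∀ᵐ b ∂ν, ∀ᵐ a ∂μ, f a b ≤ M := by
      filter_upwards [enorm_ae_le_eLpNormEssSup (fun b => eLpNormEssSup (fun a => f a b) μ) ν]
        with b hb
      filter_upwards [enorm_ae_le_eLpNormEssSup (fun a => f a b) μ] with a ha
      exact ha.trans hb
    have h2 : ∀ᵐ a ∂μ, ∀ᵐ b ∂ν, f a b ≤ M :=
      (Measure.ae_ae_comm (p := fun a b => f a b ≤ M) (measurableSet_le hf measurable_const)).2 h1
    filter_upwards [h2] with a ha
    exact essSup_le_of_ae_le _ ha
  · have hp : 0 < p.toReal := ENNReal.toReal_pos h0 ht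
    simp only [eLpNorm_eq_lintegral_rpow_enorm_toReal h0 ht, enorm_eq_self, ← ENNReal.rpow_mul,
      one_div, inv_mul_cancel₀ hp.ne', ENNReal.rpow_one]
    rw [lintegral_lintegral_swap]
    exact (hf.pow_const _).aemeasurable

end IteratedNorms

/-! ### Peetre's functional as an infimum over pairs (map, gradient). -/

section KFunctional

variable {n N : ℕ} {μ : Measure (EuclideanSpace ℝ (Fin n))}
  {D : (EuclideanSpace ℝ (Fin n) → EuclideanSpace ℝ (Fin N)) →
      (EuclideanSpace ℝ (Fin n) → GradSpace n N) → Prop} {p : ℝ≥0∞}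
  {v v' : EuclideanSpace ℝ (Fin n) → EuclideanSpace ℝ (Fin N)}

theorem kFunctional_congr (h : v =ᵐ[μ] v') (t : ℝ) :
    kFunctional μ D p v t = kFunctional μ D p v' t := by
  have : ∀ a b : EuclideanSpace ℝ (Fin n) → EuclideanSpace ℝ (Fin N),
      (MemLp a p μ ∧ v =ᵐ[μ] a + b) = (MemLp a p μ ∧ v' =ᵐ[μ] a + b) := fun a b =>
    propext (and_congr_right fun _ => ⟨fun h' => h.symm.trans h', fun h' => h.trans h'⟩)
  simp only [kFunctional, this]

theorem kFunctional_le {v₂ : EuclideanSpace ℝ (Fin n) → EuclideanSpace ℝ (Fin N)}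
    {g : EuclideanSpace ℝ (Fin n) → GradSpace n N} (hv : MemLp v p μ) (hv₂ : MemLp v₂ p μ)
    (hg : MemLp g p μ) (hD : D v₂ g) (t : ℝ) :
    kFunctional μ D p v t
      ≤ eLpNorm (v - v₂) p μ + ENNReal.ofReal t * (eLpNorm v₂ p μ + eLpNorm g p μ) := by
  refine (iInf₂_le (v - v₂) v₂).trans ((iInf_le _ ⟨hv.sub hv₂, by simp⟩).trans ?_)
  gcongr
  exact (iInf_le _ g).trans (iInf_le _ ⟨hv₂, hg, hD⟩)

/-- The term `v₁` is determined by `v₂` up to a null set. Positivity of `t` lets the product with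
`t` pass through an infimum that may be empty, since `0 * ∞ = 0`. -/
theorem kFunctional_eq_iInf (hv : MemLp v p μ) {t : ℝ} (ht : 0 < t) :
    kFunctional μ D p v t
      = ⨅ (v₂ : EuclideanSpace ℝ (Fin n) → EuclideanSpace ℝ (Fin N))
          (g : EuclideanSpace ℝ (Fin n) → GradSpace n N)
          (_ : MemLp v₂ p μ ∧ MemLp g p μ ∧ D v₂ g),
          (eLpNorm (v - v₂) p μ + ENNReal.ofReal t * (eLpNorm v₂ p μ + eLpNorm g p μ)) := by
  refine le_antisymm (le_iInf₂ fun v₂ g => le_iInf fun h => kFunctional_le hv h.1 h.2.1 h.2.2 t) ?_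
  refine le_iInf₂ fun v₁ v₂ => le_iInf fun h => ?_
  have ht0 : ENNReal.ofReal t ≠ 0 := by simpa using ht
  rw [sobolevENorm]
  simp only [ENNReal.mul_iInf_of_ne ht0 ENNReal.ofReal_ne_top, ENNReal.add_iInf]
  refine le_iInf₂ fun g hg => (iInf₂_le v₂ g).trans ((iInf_le _ hg).trans ?_)
  gcongr
  refine le_of_eq (eLpNorm_congr_ae ?_)
  filter_upwards [h.2] with x hx
  simp [hx]

end KFunctional

/-! ### A substitute for weak compactness in Hilbert spaces. -/

section Hilbert

variable {H : Type*} [NormedAddCommGroup H] [InnerProductSpace ℝ H] [CompleteSpace H]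

/-- The elements of minimal norm have increasing bounded norms, so the parallelogram law makes them
a Cauchy sequence; its limit lies in every set. -/
theorem nonempty_iInter_of_antitone_convex_isClosed {C : ℕ → Set H} (hanti : Antitone C)
    (hne : ∀ k, (C k).Nonempty) (hcl : ∀ k, IsClosed (C k)) (hconv : ∀ k, Convex ℝ (C k))
    {R : ℝ} (hbd : ∀ k, ∀ x ∈ C k, ‖x‖ ≤ R) : (⋂ k, C k).Nonempty := by
  have hmin : ∀ k, ∃ x ∈ C k, ∀ y ∈ C k, ‖x‖ ≤ ‖y‖ := by
    intro k
    obtain ⟨x, hx, hxe⟩ := exists_norm_eq_iInf_of_complete_convex (hne k) (hcl k).isComplete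
      (hconv k) 0
    refine ⟨x, hx, fun y hy => ?_⟩
    have : ‖(0 : H) - x‖ ≤ ‖(0 : H) - y‖ := by
      rw [hxe]
      exact ciInf_le ⟨0, by rintro _ ⟨z, rfl⟩; exact norm_nonneg _⟩ (⟨y, hy⟩ : C k)
    simpa using this
  choose x hx hxmin using hmin
  have hmono : Monotone fun k => ‖x k‖ := fun j k hjk => hxmin j _ (hanti hjk (hx k))
  have hbdd : BddAbove (range fun k => ‖x k‖) := ⟨R, by rintro _ ⟨k, rfl⟩; exact hbd k _ (hx k)⟩
  have hlim := tendsto_atTop_ciSup hmono hbdd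
  set L := ⨆ k, ‖x k‖
  have hle : ∀ k, ‖x k‖ ≤ L := fun k => le_ciSup hbdd k
  have hL0 : 0 ≤ L := (norm_nonneg _).trans (hle 0)
  have hdist : ∀ j k, j ≤ k → ‖x j - x k‖ ^ 2 ≤ 4 * (L ^ 2 - ‖x j‖ ^ 2) := by
    intro j k hjk
    -- The midpoint lies in the larger set `C j`, so its norm is at least that of `x j`.
    have hmid : (1 / 2 : ℝ) • x j + (1 / 2 : ℝ) • x k ∈ C j :=
      hconv j (hx j) (hanti hjk (hx k)) (by norm_num) (by norm_num) (by norm_num)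
    have h1 := hxmin j _ hmid
    rw [← smul_add, norm_smul] at h1
    have h2 := parallelogram_law_with_norm ℝ (x j) (x k)
    have h3 : 2 * ‖x j‖ ≤ ‖x j + x k‖ := by norm_num at h1; linarith
    have h4 : (2 * ‖x j‖) ^ 2 ≤ ‖x j + x k‖ ^ 2 := by gcongr
    have h5 : ‖x k‖ ^ 2 ≤ L ^ 2 := by gcongr; exact hle k
    have h6 : ‖x j‖ ^ 2 ≤ L ^ 2 := by gcongr; exact hle j
    nlinarith
  have hcau : CauchySeq x := by
    refine cauchySeq_of_le_tendsto_0 (fun j => 2 * √(4 * (L ^ 2 - ‖x j‖ ^ 2))) ?_ ?_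
    · intro a b j ha hb
      have key : ∀ k, j ≤ k → dist (x j) (x k) ≤ √(4 * (L ^ 2 - ‖x j‖ ^ 2)) := fun k hk => by
        rw [dist_eq_norm]
        exact Real.le_sqrt_of_sq_le (hdist j k hk)
      linarith [dist_triangle_left (x a) (x b) (x j), key a ha, key b hb]
    · have : Filter.Tendsto (fun j => 2 * √(4 * (L ^ 2 - ‖x j‖ ^ 2))) Filter.atTop
          (nhds (2 * √(4 * (L ^ 2 - L ^ 2)))) :=
        (((hlim.pow 2).const_sub _).const_mul _).sqrt.const_mul _
      simpa using this
  obtain ⟨z, hz⟩ := cauchySeq_tendsto_of_complete hcau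
  refine ⟨z, mem_iInter.2 fun k => (hcl k).mem_of_tendsto hz ?_⟩
  filter_upwards [Filter.eventually_ge_atTop k] with j hj
  exact hanti hj (hx j)

/-- For `w` in the closure of the image, the points of `C` sent within `1 / (k + 1)` of `w` form
nested nonempty closed convex sets; a common point is sent to `w`. -/
theorem isClosed_image_of_convex_isClosed_bounded {G : Type*} [NormedAddCommGroup G]
    [NormedSpace ℝ G] (T : H →L[ℝ] G) {C : Set H} (hcl : IsClosed C) (hconv : Convex ℝ C)
    {R : ℝ} (hbd : ∀ x ∈ C, ‖x‖ ≤ R) : IsClosed (T '' C) := by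
  refine isClosed_of_closure_subset fun w hw => ?_
  obtain ⟨z, hz⟩ := nonempty_iInter_of_antitone_convex_isClosed
    (C := fun k : ℕ => C ∩ T ⁻¹' Metric.closedBall w (1 / ((k : ℝ) + 1))) (R := R)
    (fun j k hjk => inter_subset_inter_right _ (preimage_mono
      (Metric.closedBall_subset_closedBall (Nat.one_div_le_one_div hjk))))
    (fun k => by
      obtain ⟨_, ⟨x, hx, rfl⟩, hb⟩ := Metric.mem_closure_iff.1 hw (1 / ((k : ℝ) + 1))
        Nat.one_div_pos_of_nat
      exact ⟨x, hx, by simpa [dist_comm] using hb.le⟩)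
    (fun k => hcl.inter (Metric.isClosed_closedBall.preimage T.continuous))
    (fun k => hconv.inter ((convex_closedBall _ _).linear_preimage T.toLinearMap))
    (fun k x hx => hbd x hx.1)
  rw [mem_iInter] at hz
  refine ⟨z, (hz 0).1, dist_le_zero.1 (ge_of_tendsto' tendsto_one_div_add_atTop_nhds_zero_nat
    fun k => (hz k).2)⟩

end Hilbert

/-! ### Polar coordinates and restriction of `L^p` functions to spheres. -/

section Polar

variable {n : ℕ}

instance isFiniteMeasure_sphereMeasure (r : ℝ) : IsFiniteMeasure (sphereMeasure n r) := by
  unfold sphereMeasure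
  constructor
  rw [Measure.smul_apply, smul_eq_mul]
  exact ENNReal.mul_lt_top ENNReal.ofReal_lt_top (measure_lt_top _ _)

theorem sphereMeasure_one :
    sphereMeasure n 1 = Measure.map
      (fun y : Metric.sphere (0 : EuclideanSpace ℝ (Fin n)) 1 => (y : EuclideanSpace ℝ (Fin n)))
      (volume : Measure (EuclideanSpace ℝ (Fin n))).toSphere := by
  simp [sphereMeasure]

theorem sphereMeasure_eq_smul_map (r : ℝ) :
    sphereMeasure n r
      = ENNReal.ofReal (r ^ (n - 1)) • Measure.map (fun y => r • y) (sphereMeasure n 1) := by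
  rw [sphereMeasure_one, Measure.map_map (by fun_prop) (by fun_prop)]
  rfl

theorem measurableEmbedding_smul_of_pos {r : ℝ} (hr : 0 < r) :
    MeasurableEmbedding (fun y : EuclideanSpace ℝ (Fin n) => r • y) :=
  (Homeomorph.smulOfNeZero r hr.ne').measurableEmbedding

theorem ae_sphereMeasure_iff {r : ℝ} (hr : 0 < r) {P : EuclideanSpace ℝ (Fin n) → Prop} :
    (∀ᵐ x ∂(sphereMeasure n r), P x) ↔ ∀ᵐ y ∂(sphereMeasure n 1), P (r • y) := by
  rw [sphereMeasure_eq_smul_map r, Measure.ae_ennreal_smul_measure_iff (by simp; positivity),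
    (measurableEmbedding_smul_of_pos hr).ae_map_iff]

theorem ae_sphereMeasure_one_norm : ∀ᵐ y ∂(sphereMeasure n 1), ‖y‖ = 1 := by
  rw [sphereMeasure_one, ae_map_iff (by fun_prop) (measurableSet_eq_fun (by fun_prop) (by fun_prop))]
  exact Filter.Eventually.of_forall fun y => by simp

theorem ae_sphereMeasure_norm {r : ℝ} (hr : 0 < r) : ∀ᵐ x ∂(sphereMeasure n r), ‖x‖ = r := by
  rw [ae_sphereMeasure_iff hr]
  filter_upwards [ae_sphereMeasure_one_norm] with y hy
  simp [norm_smul, hy, hr.le]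

theorem eLpNorm_sphereMeasure {ε : Type*} [TopologicalSpace ε] [ESeminormedAddMonoid ε] {r : ℝ}
    (hr : 0 < r) (f : EuclideanSpace ℝ (Fin n) → ε) (p : ℝ≥0∞) :
    eLpNorm f p (sphereMeasure n r)
      = ENNReal.ofReal (r ^ (n - 1)) ^ (1 / p).toReal
        * eLpNorm (fun y => f (r • y)) p (sphereMeasure n 1) := by
  rw [sphereMeasure_eq_smul_map r, eLpNorm_smul_measure_of_ne_zero (by simp; positivity),
    (measurableEmbedding_smul_of_pos hr).eLpNorm_map_measure]
  rfl

theorem integral_sphereMeasure {F : Type*} [NormedAddCommGroup F] [NormedSpace ℝ F] {r : ℝ}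
    (hr : 0 < r) (f : EuclideanSpace ℝ (Fin n) → F) :
    ∫ x, f x ∂(sphereMeasure n r) = r ^ (n - 1) • ∫ y, f (r • y) ∂(sphereMeasure n 1) := by
  rw [sphereMeasure_eq_smul_map r, integral_smul_measure,
    (measurableEmbedding_smul_of_pos hr).integral_map, ENNReal.toReal_ofReal (by positivity)]

theorem aestronglyMeasurable_sphereMeasure_iff {F : Type*} [TopologicalSpace F]
    [TopologicalSpace.PseudoMetrizableSpace F] {r : ℝ}
    (hr : 0 < r) {f : EuclideanSpace ℝ (Fin n) → F} :
    AEStronglyMeasurable f (sphereMeasure n r)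
      ↔ AEStronglyMeasurable (fun y => f (r • y)) (sphereMeasure n 1) := by
  have hc : ENNReal.ofReal (r ^ (n - 1)) ≠ 0 := by simp; positivity
  rw [sphereMeasure_eq_smul_map r]
  refine Iff.trans ⟨fun h => h.mono_ac (Measure.absolutelyContinuous_smul hc),
    fun h => h.mono_ac Measure.smul_absolutelyContinuous⟩
    (measurableEmbedding_smul_of_pos hr).aestronglyMeasurable_map_iff

/-- The spherical shell `{ρ < |x| < σ}`. -/
def shell (n : ℕ) (ρ σ : ℝ) : Set (EuclideanSpace ℝ (Fin n)) := {x | ‖x‖ ∈ Ioo ρ σ}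

theorem isOpen_shell (ρ σ : ℝ) : IsOpen (shell n ρ σ) := isOpen_Ioo.preimage continuous_norm

/-- The measure `r ^ (n - 1) dr` on `(ρ, σ)`. -/
noncomputable def radialMeasure (n : ℕ) (ρ σ : ℝ) : Measure ℝ :=
  (volume.restrict (Ioo ρ σ)).withDensity fun r => ENNReal.ofReal (r ^ (n - 1))

instance (ρ σ : ℝ) : SFinite (radialMeasure n ρ σ) := by
  unfold radialMeasure; infer_instance

variable {ρ σ : ℝ}

theorem ae_radialMeasure_iff (hρ : 0 ≤ ρ) {P : ℝ → Prop} :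
    (∀ᵐ r ∂(radialMeasure n ρ σ), P r) ↔ ∀ᵐ r ∂(volume.restrict (Ioo ρ σ)), P r := by
  rw [radialMeasure, ae_withDensity_iff (by fun_prop)]
  refine Filter.eventually_congr ?_
  filter_upwards [ae_restrict_mem measurableSet_Ioo] with r hr
  have : 0 < r := hρ.trans_lt hr.1
  have h0 : ENNReal.ofReal (r ^ (n - 1)) ≠ 0 := by simp; positivity
  simp [h0]

variable [Nontrivial (EuclideanSpace ℝ (Fin n))]

theorem lintegral_polar {f : EuclideanSpace ℝ (Fin n) → ℝ≥0∞} (hf : Measurable f) :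
    ∫⁻ x, f x = ∫⁻ r in Ioi (0 : ℝ), ENNReal.ofReal (r ^ (n - 1))
      * ∫⁻ y, f (r • y) ∂(sphereMeasure n 1) := by
  set S := Metric.sphere (0 : EuclideanSpace ℝ (Fin n)) 1
  have hm : Measurable fun z : S × Ioi (0 : ℝ) => f (z.2.1 • z.1.1) := hf.comp (by fun_prop)
  calc
    ∫⁻ x, f x = ∫⁻ x in {(0 : EuclideanSpace ℝ (Fin n))}ᶜ, f x := by rw [restrict_compl_singleton]
    _ = ∫⁻ x : ({(0)}ᶜ : Set (EuclideanSpace ℝ (Fin n))), f x ∂(Measure.comap Subtype.val volume) :=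
      (lintegral_subtype_comap (measurableSet_singleton _).compl f).symm
    _ = ∫⁻ z : S × Ioi (0 : ℝ), f (z.2.1 • z.1.1)
        ∂((volume : Measure (EuclideanSpace ℝ (Fin n))).toSphere.prod
          (.volumeIoiPow (Module.finrank ℝ (EuclideanSpace ℝ (Fin n)) - 1))) := by
      rw [← (volume : Measure (EuclideanSpace ℝ (Fin n))).measurePreserving_homeomorphUnitSphereProd.lintegral_comp_emb
        (Homeomorph.measurableEmbedding _)]
      refine lintegral_congr fun x => ?_
      congr 1
      have h0 : ‖(x : EuclideanSpace ℝ (Fin n))‖ ≠ 0 := norm_ne_zero_iff.2 x.2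
      simp [smul_smul, h0]
    _ = ∫⁻ r : Ioi (0 : ℝ), ∫⁻ y : S, f (r.1 • y.1) ∂(volume : Measure (EuclideanSpace ℝ (Fin n))).toSphere
        ∂(.volumeIoiPow (n - 1)) := by
      rw [lintegral_prod_symm _ hm.aemeasurable, finrank_euclideanSpace_fin]
    _ = ∫⁻ r : Ioi (0 : ℝ), ENNReal.ofReal (r.1 ^ (n - 1))
        * ∫⁻ y : S, f (r.1 • y.1) ∂(volume : Measure (EuclideanSpace ℝ (Fin n))).toSphere
        ∂(Measure.comap Subtype.val volume) := by
      rw [Measure.volumeIoiPow, lintegral_withDensity_eq_lintegral_mul _ (by fun_prop)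
        hm.lintegral_prod_left']
      rfl
    _ = ∫⁻ r in Ioi (0 : ℝ), ENNReal.ofReal (r ^ (n - 1))
        * ∫⁻ y : S, f (r • y.1) ∂(volume : Measure (EuclideanSpace ℝ (Fin n))).toSphere :=
      lintegral_subtype_comap measurableSet_Ioi fun r : ℝ => ENNReal.ofReal (r ^ (n - 1))
        * ∫⁻ y : S, f (r • y.1) ∂(volume : Measure (EuclideanSpace ℝ (Fin n))).toSphere
    _ = _ := by
      refine lintegral_congr fun r => ?_
      rw [sphereMeasure_one, lintegral_map (f := fun y => f (r • y)) (hf.comp (by fun_prop)) (by fun_prop)]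

theorem measurePreserving_smul_prod :
    MeasurePreserving (fun z : ℝ × EuclideanSpace ℝ (Fin n) => z.1 • z.2)
      (((volume.restrict (Ioi (0 : ℝ))).withDensity fun r => ENNReal.ofReal (r ^ (n - 1))).prod
        (sphereMeasure n 1)) volume := by
  refine ⟨by fun_prop, Measure.ext fun s hs => ?_⟩
  have hm : Measurable fun z : ℝ × EuclideanSpace ℝ (Fin n) =>
      s.indicator (fun _ => (1 : ℝ≥0∞)) (z.1 • z.2) :=
    (measurable_const.indicator hs).comp (by fun_prop)
  rw [Measure.map_apply (by fun_prop) hs, ← lintegral_indicator_one hs,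
    ← lintegral_indicator_one (hs.preimage (by fun_prop)),
    lintegral_polar (f := s.indicator 1) (measurable_const.indicator hs)]
  refine (lintegral_prod _ hm.aemeasurable).trans ?_
  rw [lintegral_withDensity_eq_lintegral_mul _ (by fun_prop) hm.lintegral_prod_right']
  rfl

theorem measurePreserving_smul_prod_shell (hρ : 0 ≤ ρ) :
    MeasurePreserving (fun z : ℝ × EuclideanSpace ℝ (Fin n) => z.1 • z.2)
      ((radialMeasure n ρ σ).prod (sphereMeasure n 1)) (volume.restrict (shell n ρ σ)) := by
  have h := (measurePreserving_smul_prod (n := n)).restrict_preimage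
    (isOpen_shell ρ σ).measurableSet
  convert h using 1
  have h1 : radialMeasure n ρ σ = ((volume.restrict (Ioi (0 : ℝ))).withDensity
      fun r => ENNReal.ofReal (r ^ (n - 1))).restrict (Ioo ρ σ) := by
    rw [restrict_withDensity measurableSet_Ioo, Measure.restrict_restrict measurableSet_Ioo,
      inter_eq_left.2 (show Ioo ρ σ ⊆ Ioi 0 from fun x hx => hρ.trans_lt hx.1)]
    rfl
  have h2 : ((radialMeasure n ρ σ).prod (sphereMeasure n 1))
      = ((radialMeasure n ρ σ).prod ((sphereMeasure n 1).restrict univ)) := by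
    rw [Measure.restrict_univ]
  rw [h2, h1, Measure.prod_restrict]
  -- The preimage of the shell is the cylinder over `(ρ, σ)` only up to a null set, namely where
  -- `|y| = 1` and `r > 0`.
  refine Measure.restrict_congr_set ?_
  have hy : ∀ᵐ z ∂(((volume.restrict (Ioi (0 : ℝ))).withDensity
      fun r => ENNReal.ofReal (r ^ (n - 1))).prod (sphereMeasure n 1)), ‖z.2‖ = 1 :=
    Measure.quasiMeasurePreserving_snd.ae ae_sphereMeasure_one_norm
  have hr : ∀ᵐ z ∂(((volume.restrict (Ioi (0 : ℝ))).withDensity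
      fun r => ENNReal.ofReal (r ^ (n - 1))).prod (sphereMeasure n 1)), 0 < z.1 := by
    refine Measure.quasiMeasurePreserving_fst.ae (p := fun r => 0 < r) ?_
    exact (withDensity_absolutelyContinuous _ _).ae_le (ae_restrict_mem measurableSet_Ioi)
  filter_upwards [hy, hr] with z hz1 hz2
  refine propext ?_
  change z ∈ Ioo ρ σ ×ˢ univ ↔ ‖z.1 • z.2‖ ∈ Ioo ρ σ
  rw [norm_smul, hz1, mul_one, Real.norm_of_nonneg hz2.le]
  simp

theorem ae_ae_sphereMeasure (hρ : 0 ≤ ρ) {P : EuclideanSpace ℝ (Fin n) → Prop}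
    (h : ∀ᵐ x ∂(volume.restrict (shell n ρ σ)), P x) :
    ∀ᵐ r ∂(volume.restrict (Ioo ρ σ)), ∀ᵐ x ∂(sphereMeasure n r), P x := by
  have h1 := (measurePreserving_smul_prod_shell (n := n) (σ := σ) hρ).quasiMeasurePreserving.ae h
  have h2 := (ae_radialMeasure_iff hρ).1 (Measure.ae_ae_of_ae_prod h1)
  filter_upwards [h2, ae_restrict_mem measurableSet_Ioo] with r hr hr'
  exact (ae_sphereMeasure_iff (hρ.trans_lt hr'.1)).2 hr

theorem lintegral_sphereMeasure_shell (hρ : 0 ≤ ρ) {f : EuclideanSpace ℝ (Fin n) → ℝ≥0∞}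
    (hf : AEMeasurable f (volume.restrict (shell n ρ σ))) :
    ∫⁻ r in Ioo ρ σ, ∫⁻ x, f x ∂(sphereMeasure n r) = ∫⁻ x in shell n ρ σ, f x := by
  have hmp := measurePreserving_smul_prod_shell (n := n) (σ := σ) hρ
  have h1 : ∀ᵐ r ∂(volume.restrict (Ioo ρ σ)),
      ∫⁻ x, f x ∂(sphereMeasure n r) = ∫⁻ x, hf.mk f x ∂(sphereMeasure n r) := by
    filter_upwards [ae_ae_sphereMeasure hρ hf.ae_eq_mk] with r hr
    exact lintegral_congr_ae hr
  have hm : Measurable fun z : ℝ × EuclideanSpace ℝ (Fin n) => hf.mk f (z.1 • z.2) :=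
    hf.measurable_mk.comp (by fun_prop)
  rw [lintegral_congr_ae h1, lintegral_congr_ae hf.ae_eq_mk, ← hmp.lintegral_comp hf.measurable_mk,
    lintegral_prod _ hm.aemeasurable, radialMeasure,
    lintegral_withDensity_eq_lintegral_mul _ (by fun_prop) hm.lintegral_prod_right']
  refine lintegral_congr fun r => ?_
  rw [sphereMeasure_eq_smul_map r, lintegral_smul_measure,
    lintegral_map hf.measurable_mk (by fun_prop)]
  rfl

theorem integral_integral_sphereMeasure_shell {F : Type*} [NormedAddCommGroup F] [NormedSpace ℝ F]
    (hρ : 0 ≤ ρ) {f : EuclideanSpace ℝ (Fin n) → F}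
    (hf : IntegrableOn f (shell n ρ σ)) :
    IntegrableOn (fun r => ∫ x, f x ∂(sphereMeasure n r)) (Ioo ρ σ) ∧
    ∫ r in Ioo ρ σ, ∫ x, f x ∂(sphereMeasure n r) = ∫ x in shell n ρ σ, f x := by
  have hmp := measurePreserving_smul_prod_shell (n := n) (σ := σ) hρ
  have hd : Measurable fun r : ℝ => Real.toNNReal (r ^ (n - 1)) := by fun_prop
  have hrm : radialMeasure n ρ σ = (volume.restrict (Ioo ρ σ)).withDensity
    fun r => ((Real.toNNReal (r ^ (n - 1)) : ℝ≥0) : ℝ≥0∞) := rfl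
  have hi : Integrable (fun z : ℝ × EuclideanSpace ℝ (Fin n) => f (z.1 • z.2))
      ((radialMeasure n ρ σ).prod (sphereMeasure n 1)) := hmp.integrable_comp_of_integrable hf
  have hi1 := hi.integral_prod_left
  have heq : ∀ r ∈ Ioo ρ σ, Real.toNNReal (r ^ (n - 1)) • ∫ y, f (r • y) ∂(sphereMeasure n 1)
      = ∫ x, f x ∂(sphereMeasure n r) := fun r hr => by
    have : 0 < r := hρ.trans_lt hr.1
    rw [integral_sphereMeasure this, NNReal.smul_def, Real.coe_toNNReal _ (by positivity)]
  constructor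
  · rw [hrm, integrable_withDensity_iff_integrable_smul hd] at hi1
    refine (integrableOn_congr_fun (fun r hr => ?_) measurableSet_Ioo).1 hi1
    exact heq r hr
  · have h1 : ∫ x in shell n ρ σ, f x
        = ∫ z, f (z.1 • z.2) ∂((radialMeasure n ρ σ).prod (sphereMeasure n 1)) := by
      rw [← hmp.map_eq, integral_map hmp.measurable.aemeasurable]
      rw [hmp.map_eq]
      exact hf.aestronglyMeasurable
    rw [h1, integral_prod _ hi, hrm, integral_withDensity_eq_integral_smul hd]
    exact setIntegral_congr_fun measurableSet_Ioo fun r hr => (heq r hr).symm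

section Norms

variable {F : Type*} [NormedAddCommGroup F] {p : ℝ≥0∞}

theorem ae_aestronglyMeasurable_sphereMeasure (hρ : 0 ≤ ρ) {f : EuclideanSpace ℝ (Fin n) → F}
    (hf : AEStronglyMeasurable f (volume.restrict (shell n ρ σ))) :
    ∀ᵐ r ∂(volume.restrict (Ioo ρ σ)), AEStronglyMeasurable f (sphereMeasure n r) := by
  filter_upwards [ae_ae_sphereMeasure hρ hf.ae_eq_mk] with r hr
  exact ⟨_, hf.stronglyMeasurable_mk, hr⟩

theorem aemeasurable_eLpNorm_sphereMeasure (hρ : 0 ≤ ρ) {f : EuclideanSpace ℝ (Fin n) → F}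
    (hf : AEStronglyMeasurable f (volume.restrict (shell n ρ σ))) :
    AEMeasurable (fun r => eLpNorm f p (sphereMeasure n r)) (volume.restrict (Ioo ρ σ)) := by
  refine ⟨fun r => ENNReal.ofReal (r ^ (n - 1)) ^ (1 / p).toReal
      * eLpNorm (fun y => hf.mk f (r • y)) p (sphereMeasure n 1), ?_, ?_⟩
  · refine Measurable.mul (by fun_prop) (measurable_eLpNorm_of_measurable_enorm p _ ?_)
    exact (hf.stronglyMeasurable_mk.comp_measurable (by fun_prop)).enorm
  · filter_upwards [ae_ae_sphereMeasure hρ hf.ae_eq_mk, ae_restrict_mem measurableSet_Ioo]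
      with r hr hr'
    rw [eLpNorm_congr_ae hr, eLpNorm_sphereMeasure (hρ.trans_lt hr'.1)]

/-- Polar coordinates applied to `|f|^p` when `p < ∞`; for `p = ∞`, an a.e. bound on the shell holds
a.e. on almost every sphere. -/
theorem eLpNorm_eLpNorm_sphereMeasure_le (hρ : 0 ≤ ρ) (hp : p ≠ 0)
    {f : EuclideanSpace ℝ (Fin n) → F}
    (hf : AEStronglyMeasurable f (volume.restrict (shell n ρ σ))) :
    eLpNorm (fun r => eLpNorm f p (sphereMeasure n r)) p (volume.restrict (Ioo ρ σ))
      ≤ eLpNorm f p (volume.restrict (shell n ρ σ)) := by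
  by_cases ht : p = ⊤
  · subst ht
    simp only [eLpNorm_exponent_top]
    refine essSup_le_of_ae_le _ ?_
    filter_upwards [ae_ae_sphereMeasure hρ (enorm_ae_le_eLpNormEssSup f _)] with r hr
    exact essSup_le_of_ae_le _ hr
  · have hp0 : 0 < p.toReal := ENNReal.toReal_pos hp ht
    simp only [eLpNorm_eq_lintegral_rpow_enorm_toReal hp ht, enorm_eq_self, ← ENNReal.rpow_mul,
      one_div, inv_mul_cancel₀ hp0.ne', ENNReal.rpow_one]
    rw [lintegral_sphereMeasure_shell hρ (hf.enorm.pow_const _)]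

theorem ae_memLp_sphereMeasure (hρ : 0 ≤ ρ) (hp : p ≠ 0) {f : EuclideanSpace ℝ (Fin n) → F}
    (hf : MemLp f p (volume.restrict (shell n ρ σ))) :
    ∀ᵐ r ∂(volume.restrict (Ioo ρ σ)), MemLp f p (sphereMeasure n r) := by
  have h1 := (eLpNorm_eLpNorm_sphereMeasure_le hρ hp hf.1).trans_lt hf.2
  have hfin : ∀ᵐ r ∂(volume.restrict (Ioo ρ σ)), eLpNorm f p (sphereMeasure n r) < ⊤ := by
    by_cases ht : p = ⊤
    · subst ht
      rw [eLpNorm_exponent_top] at h1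
      filter_upwards [enorm_ae_le_eLpNormEssSup
        (fun r => eLpNorm f ⊤ (sphereMeasure n r)) (volume.restrict (Ioo ρ σ))] with r hr
      exact hr.trans_lt h1
    · have hp0 : 0 < p.toReal := ENNReal.toReal_pos hp ht
      have h2 := lintegral_rpow_enorm_lt_top_of_eLpNorm_lt_top hp ht h1
      filter_upwards [ae_lt_top' ((aemeasurable_eLpNorm_sphereMeasure hρ hf.1).pow_const _) h2.ne]
        with r hr
      exact (ENNReal.rpow_lt_top_iff_of_pos hp0).1 hr
  filter_upwards [ae_aestronglyMeasurable_sphereMeasure hρ hf.1, hfin] with r hr1 hr2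
  exact ⟨hr1, hr2⟩

end Norms

end Polar

/-! ### Radial cutoff functions. -/

section RadialCutoff

variable {n : ℕ} {ρ σ : ℝ} {η : ℝ → ℝ}

theorem tsupport_comp_norm_subset (hsupp : tsupport η ⊆ Ioo ρ σ) :
    tsupport (fun x : EuclideanSpace ℝ (Fin n) => η ‖x‖) ⊆ shell n ρ σ := by
  have h : tsupport (fun x : EuclideanSpace ℝ (Fin n) => η ‖x‖) ⊆ (fun x => ‖x‖) ⁻¹' tsupport η :=
    closure_minimal (fun x hx => subset_tsupport η hx)
      ((isClosed_tsupport η).preimage continuous_norm)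
  exact h.trans (preimage_mono hsupp)

theorem hasCompactSupport_comp_norm (hsupp : tsupport η ⊆ Ioo ρ σ) :
    HasCompactSupport (fun x : EuclideanSpace ℝ (Fin n) => η ‖x‖) := by
  refine Metric.isCompact_of_isClosed_isBounded (isClosed_tsupport _) ?_
  refine (Metric.isBounded_ball (x := 0) (r := σ)).subset fun x hx => ?_
  simpa using (tsupport_comp_norm_subset hsupp hx).2

theorem ne_zero_of_mem_tsupport_comp_norm (hρ : 0 ≤ ρ) (hsupp : tsupport η ⊆ Ioo ρ σ)
    {x : EuclideanSpace ℝ (Fin n)} (hx : x ∈ tsupport fun x : EuclideanSpace ℝ (Fin n) => η ‖x‖) :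
    x ≠ 0 :=
  norm_pos_iff.1 (hρ.trans_lt (tsupport_comp_norm_subset hsupp hx).1)

/-- The norm fails to be smooth only at the origin, which the support condition excludes as `ρ ≥ 0`.
-/
theorem contDiff_comp_norm (hρ : 0 ≤ ρ) (hη : ContDiff ℝ ∞ η) (hsupp : tsupport η ⊆ Ioo ρ σ) :
    ContDiff ℝ ∞ (fun x : EuclideanSpace ℝ (Fin n) => η ‖x‖) :=
  contMDiff_iff_contDiff.1 <| contMDiff_of_tsupport fun _ hx =>
    (hη.contDiffAt.comp _ (contDiffAt_norm ℝ
      (ne_zero_of_mem_tsupport_comp_norm hρ hsupp hx))).contMDiffAt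

/-- The gradient of a radial function is radial. -/
theorem fderiv_comp_norm_apply_eq_zero (hρ : 0 ≤ ρ) (hη : ContDiff ℝ ∞ η)
    (hsupp : tsupport η ⊆ Ioo ρ σ) {x h : EuclideanSpace ℝ (Fin n)} (hxh : inner ℝ h x = 0) :
    fderiv ℝ (fun x : EuclideanSpace ℝ (Fin n) => η ‖x‖) x h = 0 := by
  by_cases hx : x ∈ tsupport fun x : EuclideanSpace ℝ (Fin n) => η ‖x‖
  · have hx0 := ne_zero_of_mem_tsupport_comp_norm hρ hsupp hx
    -- Writing the norm as `√(‖y‖ ^ 2)` exhibits its derivative as a multiple of `⟨x, ·⟩`.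
    have h1 : HasFDerivAt (fun y : EuclideanSpace ℝ (Fin n) => √(‖y‖ ^ 2)) _ x :=
      (hasStrictFDerivAt_norm_sq x).hasFDerivAt.sqrt (by simpa using hx0)
    have h2 := ((hη.differentiable (by simp)) (√(‖x‖ ^ 2))).hasDerivAt.comp_hasFDerivAt x h1
    have h3 : (η ∘ fun y : EuclideanSpace ℝ (Fin n) => √(‖y‖ ^ 2)) = fun y => η ‖y‖ := by
      funext y; simp
    rw [h3] at h2
    rw [h2.fderiv]
    have hxh' : inner ℝ x h = 0 := (real_inner_comm _ _).trans hxh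
    simp [hxh']
  · rw [fderiv_of_notMem_tsupport ℝ hx]; simp

end RadialCutoff

/-! ### The integrand of the integration by parts formula and its `C¹` stability. -/

section Divergence

variable {n N : ℕ}

/-- The divergence of a vector field on `ℝⁿ`. -/
noncomputable def divergence (X : EuclideanSpace ℝ (Fin n) → EuclideanSpace ℝ (Fin n))
    (x : EuclideanSpace ℝ (Fin n)) : ℝ :=
  ∑ i, (fderiv ℝ X x (EuclideanSpace.single i 1)) i

/-- The integrand `u div X + X · w` of the integration by parts formula. -/
noncomputable def divergencePairing (X : EuclideanSpace ℝ (Fin n) → EuclideanSpace ℝ (Fin n))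
    (u : EuclideanSpace ℝ (Fin n) → EuclideanSpace ℝ (Fin N))
    (w : EuclideanSpace ℝ (Fin n) → GradSpace n N) (x : EuclideanSpace ℝ (Fin n)) :
    EuclideanSpace ℝ (Fin N) :=
  divergence X x • u x + ∑ i, X x i • w x i

variable {X Y : EuclideanSpace ℝ (Fin n) → EuclideanSpace ℝ (Fin n)}
  {u : EuclideanSpace ℝ (Fin n) → EuclideanSpace ℝ (Fin N)}
  {w : EuclideanSpace ℝ (Fin n) → GradSpace n N}

theorem continuous_divergence (hX : ContDiff ℝ ∞ X) : Continuous (divergence X) := by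
  have : Continuous (fderiv ℝ X) := hX.continuous_fderiv (by simp)
  unfold divergence
  fun_prop

theorem norm_divergencePairing_sub_le {ε : ℝ} {x : EuclideanSpace ℝ (Fin n)}
    (h0 : ‖X x - Y x‖ ≤ ε) (h1 : ‖fderiv ℝ X x - fderiv ℝ Y x‖ ≤ ε) :
    ‖divergencePairing X u w x - divergencePairing Y u w x‖ ≤ n * ε * (‖u x‖ + ‖w x‖) := by
  have e : divergencePairing X u w x - divergencePairing Y u w x
      = ∑ i, (((fderiv ℝ X x - fderiv ℝ Y x) (EuclideanSpace.single i 1)) i • u x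
        + (X x - Y x) i • w x i) := by
    simp only [divergencePairing, divergence, Finset.sum_add_distrib, ← Finset.sum_smul,
      _root_.sub_apply, PiLp.sub_apply, sub_smul, Finset.sum_sub_distrib]
    abel
  rw [e]
  refine (norm_sum_le_of_le _ (f := fun i => _) (n := fun _ => ε * ‖u x‖ + ε * ‖w x‖)
    fun i _ => ?_).trans_eq (by simp; ring)
  refine (norm_add_le _ _).trans (add_le_add ?_ ?_)
  · rw [norm_smul]
    gcongr
    refine (PiLp.norm_apply_le _ i).trans ((ContinuousLinearMap.le_opNorm _ _).trans ?_)
    simpa using h1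
  · rw [norm_smul]
    gcongr
    · exact (norm_nonneg _).trans h0
    · exact (PiLp.norm_apply_le _ i).trans h0
    · exact PiLp.norm_apply_le _ i

theorem MeasureTheory.Integrable.piLp_apply {μ : Measure (EuclideanSpace ℝ (Fin n))}
    (hw : Integrable w μ) (i : Fin n) : Integrable (fun x => w x i) μ :=
  (PiLp.proj (𝕜 := ℝ) 2 (fun _ : Fin n => EuclideanSpace ℝ (Fin N)) i).integrable_comp hw

theorem integrable_divergencePairing {μ : Measure (EuclideanSpace ℝ (Fin n))} {R : ℝ}
    (hμ : ∀ᵐ x ∂μ, ‖x‖ ≤ R) (hX : ContDiff ℝ ∞ X) (hu : Integrable u μ) (hw : Integrable w μ) :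
    Integrable (divergencePairing X u w) μ := by
  have hbd : ∀ f : EuclideanSpace ℝ (Fin n) → ℝ, Continuous f → ∃ C, ∀ᵐ x ∂μ, ‖f x‖ ≤ C := by
    intro f hf
    obtain ⟨C, hC⟩ := (isCompact_closedBall (0 : EuclideanSpace ℝ (Fin n)) R).exists_bound_of_continuousOn
      hf.continuousOn
    exact ⟨C, hμ.mono fun x hx => hC x (by simpa using hx)⟩
  refine Integrable.add ?_ (integrable_finsetSum _ fun i _ => ?_)
  · obtain ⟨C, hC⟩ := hbd _ (continuous_divergence hX)
    exact hu.bdd_smul _ (continuous_divergence hX).aestronglyMeasurable hC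
  · have hc : Continuous fun x => X x i := by have := hX.continuous; fun_prop
    obtain ⟨C, hC⟩ := hbd _ hc
    exact (hw.piLp_apply i).bdd_smul _ hc.aestronglyMeasurable hC

end Divergence

/-! ### Integration by parts on almost every sphere. -/

section Slicing

variable {n N : ℕ} {u : EuclideanSpace ℝ (Fin n) → EuclideanSpace ℝ (Fin N)}
  {w : EuclideanSpace ℝ (Fin n) → GradSpace n N}

theorem IsWeakGradient.mono {Ω U : Set (EuclideanSpace ℝ (Fin n))} (h : IsWeakGradient Ω u w)
    (hΩ : MeasurableSet Ω) (hUΩ : U ⊆ Ω) : IsWeakGradient U u w := by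
  intro φ hφ hc hs i
  have h1 := h φ hφ hc (hs.trans hUΩ) i
  rw [setIntegral_eq_of_subset_of_forall_sdiff_eq_zero hΩ hUΩ,
    setIntegral_eq_of_subset_of_forall_sdiff_eq_zero hΩ hUΩ] at h1
  · exact h1
  · intro x hx
    rw [image_eq_zero_of_notMem_tsupport fun hx' => hx.2 (hs hx'), zero_smul]
  · intro x hx
    rw [fderiv_of_notMem_tsupport ℝ fun hx' => hx.2 (hs hx')]
    simp

variable {ρ σ : ℝ} {X : EuclideanSpace ℝ (Fin n) → EuclideanSpace ℝ (Fin n)}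

/-- Sum over `i` the weak gradient identity for the test functions `η(|x|) Xᵢ`: the terms with a
derivative of the cutoff add up to its derivative along `X`, which vanishes. -/
theorem IsWeakGradient.integral_cutoff_smul_divergencePairing (hρ : 0 ≤ ρ)
    (h : IsWeakGradient (shell n ρ σ) u w)
    (hu : IntegrableOn u (shell n ρ σ)) (hw : IntegrableOn w (shell n ρ σ))
    (hX : ContDiff ℝ ∞ X) (hXt : ∀ x, inner ℝ (X x) x = 0) {η : ℝ → ℝ} (hη : ContDiff ℝ ∞ η)
    (hsupp : tsupport η ⊆ Ioo ρ σ) :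
    ∫ x in shell n ρ σ, η ‖x‖ • divergencePairing X u w x = 0 := by
  set f : EuclideanSpace ℝ (Fin n) → ℝ := fun x => η ‖x‖ with hf_def
  have hf : ContDiff ℝ ∞ f := contDiff_comp_norm hρ hη hsupp
  have hfc : HasCompactSupport f := hasCompactSupport_comp_norm hsupp
  have hfs : tsupport f ⊆ shell n ρ σ := tsupport_comp_norm_subset hsupp
  have hXi : ∀ i, ContDiff ℝ ∞ fun x => X x i := fun i =>
    (PiLp.proj (𝕜 := ℝ) 2 (fun _ : Fin n => ℝ) i).contDiff.comp hX
  set φ : Fin n → EuclideanSpace ℝ (Fin n) → ℝ := fun i x => f x * X x i with hφ_def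
  have hφ : ∀ i, ContDiff ℝ ∞ (φ i) := fun i => hf.mul (hXi i)
  have hφc : ∀ i, HasCompactSupport (φ i) := fun i => hfc.mul_right
  have hφs : ∀ i, tsupport (φ i) ⊆ shell n ρ σ := fun i => (tsupport_mul_subset_left).trans hfs
  have hi1 : ∀ i, IntegrableOn (fun x => fderiv ℝ (φ i) x (EuclideanSpace.single i 1) • u x)
      (shell n ρ σ) := fun i => by
    have hc : Continuous fun x => fderiv ℝ (φ i) x (EuclideanSpace.single i 1) :=
      ((hφ i).continuous_fderiv (by simp)).clm_apply continuous_const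
    obtain ⟨C, hC⟩ := hc.bounded_above_of_compact_support ((hφc i).fderiv_apply ℝ _)
    exact hu.bdd_smul _ hc.aestronglyMeasurable (Filter.Eventually.of_forall hC)
  have hi2 : ∀ i, IntegrableOn (fun x => φ i x • w x i) (shell n ρ σ) := fun i => by
    obtain ⟨C, hC⟩ := (hφ i).continuous.bounded_above_of_compact_support (hφc i)
    exact (hw.piLp_apply i).bdd_smul _ (hφ i).continuous.aestronglyMeasurable
      (Filter.Eventually.of_forall hC)
  have hpt : ∀ x, f x • divergencePairing X u w x
      = ∑ i, (fderiv ℝ (φ i) x (EuclideanSpace.single i 1) • u x + φ i x • w x i) := by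
    intro x
    have hd : ∀ i, fderiv ℝ (φ i) x (EuclideanSpace.single i 1)
        = f x * (fderiv ℝ X x (EuclideanSpace.single i 1)) i
          + X x i * fderiv ℝ f x (EuclideanSpace.single i 1) := by
      intro i
      have h1 : HasFDerivAt (fun x => X x i)
          ((PiLp.proj (𝕜 := ℝ) 2 (fun _ : Fin n => ℝ) i).comp (fderiv ℝ X x)) x :=
        (PiLp.proj (𝕜 := ℝ) 2 (fun _ : Fin n => ℝ) i).hasFDerivAt.comp x
          ((hX.differentiable (by simp)) x).hasFDerivAt
      have h2 : HasFDerivAt (φ i) _ x := ((hf.differentiable (by simp)) x).hasFDerivAt.mul h1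
      rw [h2.fderiv]
      simp
    have hsum : ∑ i, X x i * fderiv ℝ f x (EuclideanSpace.single i 1) = 0 := by
      rw [← fderiv_comp_norm_apply_eq_zero hρ hη hsupp (hXt x)]
      conv_rhs => rw [← (EuclideanSpace.basisFun (Fin n) ℝ).sum_repr (X x), map_sum]
      simp [f]
    rw [Finset.sum_add_distrib, ← Finset.sum_smul, Finset.sum_congr rfl fun i _ => hd i,
      Finset.sum_add_distrib, hsum, add_zero, ← Finset.mul_sum]
    simp [divergencePairing, divergence, φ, smul_add, smul_smul, Finset.smul_sum]
  rw [integral_congr_ae (Filter.Eventually.of_forall hpt),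
    integral_finsetSum (f := fun i x => fderiv ℝ (φ i) x (EuclideanSpace.single i 1) • u x
      + φ i x • w x i) _ fun i _ => (hi1 i).add (hi2 i)]
  refine Finset.sum_eq_zero fun i _ => ?_
  rw [integral_add (hi1 i) (hi2 i), h (φ i) (hφ i) (hφc i) (hφs i) i]
  simp

variable [Nontrivial (EuclideanSpace ℝ (Fin n))]

/-- In polar coordinates the previous identity says that the spherical integral, as a function of
`r`, is orthogonal to every cutoff `η`; the fundamental lemma of the calculus of variations applies.
-/
theorem IsWeakGradient.ae_integral_divergencePairing_eq_zero (hρ : 0 ≤ ρ)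
    (h : IsWeakGradient (shell n ρ σ) u w)
    (hu : IntegrableOn u (shell n ρ σ)) (hw : IntegrableOn w (shell n ρ σ))
    (hX : ContDiff ℝ ∞ X) (hXt : ∀ x, inner ℝ (X x) x = 0) :
    ∀ᵐ r ∂(volume.restrict (Ioo ρ σ)), ∫ x, divergencePairing X u w x ∂(sphereMeasure n r) = 0 := by
  have hU : ∀ᵐ x ∂(volume.restrict (shell n ρ σ)), ‖x‖ ≤ σ := by
    filter_upwards [ae_restrict_mem (isOpen_shell ρ σ).measurableSet] with x hx using hx.2.le
  have hG : IntegrableOn (divergencePairing X u w) (shell n ρ σ) :=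
    integrable_divergencePairing hU hX hu hw
  have h1 := (integral_integral_sphereMeasure_shell hρ hG).1
  rw [ae_restrict_iff' measurableSet_Ioo]
  refine isOpen_Ioo.ae_eq_zero_of_integral_contDiff_smul_eq_zero h1.locallyIntegrableOn
    fun η hη hηc hηs => ?_
  have hηG : IntegrableOn (fun x => η ‖x‖ • divergencePairing X u w x) (shell n ρ σ) := by
    obtain ⟨C, hC⟩ := hη.continuous.bounded_above_of_compact_support hηc
    have hc : Continuous fun x : EuclideanSpace ℝ (Fin n) => η ‖x‖ :=
      hη.continuous.comp continuous_norm
    exact hG.bdd_smul _ hc.aestronglyMeasurable (Filter.Eventually.of_forall fun x => hC _)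
  rw [← h.integral_cutoff_smul_divergencePairing hρ hu hw hX hXt hη hηs,
    ← (integral_integral_sphereMeasure_shell hρ hηG).2,
    ← setIntegral_eq_integral_of_forall_compl_eq_zero (s := Ioo ρ σ)]
  · refine setIntegral_congr_fun measurableSet_Ioo fun r hr => ?_
    beta_reduce
    rw [← integral_smul]
    refine integral_congr_ae ?_
    filter_upwards [ae_sphereMeasure_norm (hρ.trans_lt hr.1)] with x hx
    rw [hx]
  · intro r hr
    rw [image_eq_zero_of_notMem_tsupport fun hr' => hr (hηs hr'), zero_smul]

omit [Nontrivial (EuclideanSpace ℝ (Fin n))] in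
-- Sending a field to itself and its derivative embeds the tangential fields in the separable space
-- of continuous maps on a closed ball; subsets of separable metric spaces are separable, so the
-- approximants can be tangential too.
theorem exists_countable_approx_tangential (n : ℕ) (R : ℝ) :
    ∃ T : Set (EuclideanSpace ℝ (Fin n) → EuclideanSpace ℝ (Fin n)), T.Countable ∧
      (∀ Y ∈ T, ContDiff ℝ ∞ Y ∧ ∀ x, inner ℝ (Y x) x = 0) ∧
      ∀ X : EuclideanSpace ℝ (Fin n) → EuclideanSpace ℝ (Fin n), ContDiff ℝ ∞ X →
        (∀ x, inner ℝ (X x) x = 0) → ∀ ε > 0, ∃ Y ∈ T, ∀ x, ‖x‖ ≤ R →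
          ‖X x - Y x‖ ≤ ε ∧ ‖fderiv ℝ X x - fderiv ℝ Y x‖ ≤ ε := by
  let E := EuclideanSpace ℝ (Fin n)
  let K := Metric.closedBall (0 : E) R
  have : CompactSpace K := isCompact_iff_compactSpace.1 (isCompact_closedBall _ _)
  let 𝒳 := {X : E → E // ContDiff ℝ ∞ X ∧ ∀ x, inner ℝ (X x) x = 0}
  let J : 𝒳 → C(K, E × (E →L[ℝ] E)) := fun X =>
    ⟨fun x => (X.1 x, fderiv ℝ X.1 x), by
      have h1 : Continuous X.1 := X.2.1.continuous
      have h2 : Continuous (fderiv ℝ X.1) := X.2.1.continuous_fderiv (by simp)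
      exact (h1.comp continuous_subtype_val).prodMk (h2.comp continuous_subtype_val)⟩
  obtain ⟨t, htJ, htc, hJt⟩ :=
    (TopologicalSpace.IsSeparable.of_separableSpace (range J)).exists_countable_dense_subset
  have hne : Nonempty 𝒳 := ⟨⟨0, contDiff_const, by simp⟩⟩
  choose! g hg using fun Z (hZ : Z ∈ t) => htJ hZ
  refine ⟨(fun Z => (g Z).1) '' t, htc.image _, ?_, fun X h1 h2 ε hε => ?_⟩
  · rintro _ ⟨Z, -, rfl⟩
    exact (g Z).2
  · have hmem : J ⟨X, h1, h2⟩ ∈ closure t := hJt ⟨_, rfl⟩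
    obtain ⟨Z, hZ, hd⟩ := (Metric.mem_closure_iff (α := C(K, E × (E →L[ℝ] E)))).1 hmem ε hε
    refine ⟨_, ⟨Z, hZ, rfl⟩, fun x hx => ?_⟩
    rw [← hg Z hZ] at hd
    have h3 := (ContinuousMap.dist_apply_le_dist (⟨x, by simpa [K] using hx⟩ : K)).trans hd.le
    rw [Prod.dist_eq, max_le_iff] at h3
    exact ⟨(dist_eq_norm _ _).symm.trans_le h3.1, (dist_eq_norm _ _).symm.trans_le h3.2⟩

/-- Discard the null sets of radii of a countable dense family of fields; on the remaining spheres
the formula passes to `C¹` limits because `u` and `w` are integrable there. -/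
theorem IsWeakGradient.ae_forall_integral_divergencePairing_eq_zero (hρ : 0 ≤ ρ)
    (h : IsWeakGradient (shell n ρ σ) u w)
    (hu : IntegrableOn u (shell n ρ σ)) (hw : IntegrableOn w (shell n ρ σ)) :
    ∀ᵐ r ∂(volume.restrict (Ioo ρ σ)), ∀ X : EuclideanSpace ℝ (Fin n) → EuclideanSpace ℝ (Fin n),
      ContDiff ℝ ∞ X → (∀ x, inner ℝ (X x) x = 0) →
        ∫ x, divergencePairing X u w x ∂(sphereMeasure n r) = 0 := by
  obtain ⟨T, hTc, hT, happ⟩ := exists_countable_approx_tangential n σ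
  have h1 : ∀ᵐ r ∂(volume.restrict (Ioo ρ σ)), ∀ Y ∈ T,
      ∫ x, divergencePairing Y u w x ∂(sphereMeasure n r) = 0 :=
    (ae_ball_iff hTc).2 fun Y hY =>
      h.ae_integral_divergencePairing_eq_zero hρ hu hw (hT Y hY).1 (hT Y hY).2
  have hu' := ae_memLp_sphereMeasure hρ one_ne_zero (memLp_one_iff_integrable.2 hu)
  have hw' := ae_memLp_sphereMeasure hρ one_ne_zero (memLp_one_iff_integrable.2 hw)
  filter_upwards [h1, hu', hw', ae_restrict_mem measurableSet_Ioo] with r hr hur hwr hrm X hX hXt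
  rw [memLp_one_iff_integrable] at hur hwr
  have hnorm : ∀ᵐ x ∂(sphereMeasure n r), ‖x‖ ≤ σ := by
    filter_upwards [ae_sphereMeasure_norm (hρ.trans_lt hrm.1)] with x hx
    exact hx.trans_le hrm.2.le
  set M := ∫ x, (‖u x‖ + ‖w x‖) ∂(sphereMeasure n r)
  have key : ∀ ε > 0, ‖∫ x, divergencePairing X u w x ∂(sphereMeasure n r)‖ ≤ n * ε * M := by
    intro ε hε
    obtain ⟨Y, hY, hXY⟩ := happ X hX hXt ε hε
    rw [← sub_zero (∫ x, divergencePairing X u w x ∂(sphereMeasure n r)), ← hr Y hY,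
      ← integral_sub (integrable_divergencePairing hnorm hX hur hwr)
        (integrable_divergencePairing hnorm (hT Y hY).1 hur hwr), ← integral_const_mul]
    refine norm_integral_le_of_norm_le ((hur.norm.add hwr.norm).const_mul _) ?_
    filter_upwards [hnorm] with x hx
    exact norm_divergencePairing_sub_le (hXY x hx).1 (hXY x hx).2
  have hlim : Filter.Tendsto (fun ε : ℝ => n * ε * M) (nhdsWithin 0 (Ioi 0)) (nhds (n * 0 * M)) := by
    refine Filter.Tendsto.mono_left ?_ nhdsWithin_le_nhds
    exact (by fun_prop : Continuous fun ε : ℝ => n * ε * M).tendsto 0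
  have := ge_of_tendsto hlim (Filter.eventually_of_mem self_mem_nhdsWithin key)
  simpa using this

end Slicing

/-! ### The tangential part of a gradient. -/

section TangentialPart

variable {n N : ℕ}

/-- The tangential part of a gradient field with respect to spheres centred at the origin. -/
noncomputable def tangentialPart (w : EuclideanSpace ℝ (Fin n) → GradSpace n N)
    (x : EuclideanSpace ℝ (Fin n)) : GradSpace n N :=
  WithLp.toLp 2 fun i => w x i - (x i / ‖x‖ ^ 2) • ∑ j, x j • w x j

variable (w : EuclideanSpace ℝ (Fin n) → GradSpace n N) (x : EuclideanSpace ℝ (Fin n))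

/-- Pythagoras: the tangential part is an orthogonal projection. At `x = 0` division by zero leaves
`w` unchanged. -/
theorem norm_tangentialPart_le : ‖tangentialPart w x‖ ≤ ‖w x‖ := by
  set S := ∑ j, x j • w x j with hS
  have hx : ∑ i, x i ^ 2 = ‖x‖ ^ 2 := by simp [EuclideanSpace.norm_sq_eq]
  have h1 : ‖tangentialPart w x‖ ^ 2
      = ‖w x‖ ^ 2 - 2 / ‖x‖ ^ 2 * ‖S‖ ^ 2 + ‖x‖ ^ 2 / (‖x‖ ^ 2) ^ 2 * ‖S‖ ^ 2 := by
    have e1 : ‖S‖ ^ 2 = ∑ i, x i * inner ℝ (w x i) S := by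
      rw [← real_inner_self_eq_norm_sq]
      conv_lhs => enter [2]; rw [hS]
      simp [sum_inner, inner_smul_left]
    have e2 : ∀ i, ‖tangentialPart w x i‖ ^ 2 = ‖w x i‖ ^ 2
        - 2 / ‖x‖ ^ 2 * (x i * inner ℝ (w x i) S) + x i ^ 2 / (‖x‖ ^ 2) ^ 2 * ‖S‖ ^ 2 := by
      intro i
      change ‖w x i - (x i / ‖x‖ ^ 2) • S‖ ^ 2 = _
      rw [norm_sub_sq_real, inner_smul_right, norm_smul, mul_pow, Real.norm_eq_abs, sq_abs, div_pow]
      ring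
    rw [PiLp.norm_sq_eq_of_L2, PiLp.norm_sq_eq_of_L2, Finset.sum_congr rfl fun i _ => e2 i,
      Finset.sum_add_distrib, Finset.sum_sub_distrib, ← Finset.mul_sum, ← e1, ← Finset.sum_mul,
      ← Finset.sum_div, hx]
  have h2 : ‖tangentialPart w x‖ ^ 2 ≤ ‖w x‖ ^ 2 := by
    rw [h1]
    by_cases h0 : ‖x‖ ^ 2 = 0
    · simp [h0]
    · have e : ‖x‖ ^ 2 / (‖x‖ ^ 2) ^ 2 * ‖S‖ ^ 2 = 1 / ‖x‖ ^ 2 * ‖S‖ ^ 2 := by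
        field_simp
      have e' : 2 / ‖x‖ ^ 2 * ‖S‖ ^ 2 = 2 * (1 / ‖x‖ ^ 2 * ‖S‖ ^ 2) := by ring
      have : 0 ≤ 1 / ‖x‖ ^ 2 * ‖S‖ ^ 2 := by positivity
      rw [e, e']; linarith
  exact (sq_le_sq₀ (norm_nonneg _) (norm_nonneg _)).1 h2

theorem sum_smul_tangentialPart : ∑ i, x i • tangentialPart w x i = 0 := by
  have hx : ∑ i, x i ^ 2 = ‖x‖ ^ 2 := by simp [EuclideanSpace.norm_sq_eq]
  by_cases h0 : x = 0
  · simp [h0]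
  simp only [tangentialPart, smul_sub, smul_smul, Finset.sum_sub_distrib, ← Finset.sum_smul,
    mul_div_assoc', ← Finset.sum_div, ← pow_two, hx]
  rw [div_self (by simpa using h0), one_smul, sub_self]

theorem sum_smul_tangentialPart_of_inner_eq_zero {h : EuclideanSpace ℝ (Fin n)}
    (hx : inner ℝ h x = 0) : ∑ i, h i • tangentialPart w x i = ∑ i, h i • w x i := by
  have hx' : ∑ i, h i * x i = 0 := by
    rw [← hx, PiLp.inner_apply]
    simp [mul_comm]
  simp only [tangentialPart, smul_sub, smul_smul, Finset.sum_sub_distrib, ← Finset.sum_smul,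
    mul_div_assoc', ← Finset.sum_div, hx']
  simp

variable {w}

theorem MeasureTheory.MemLp.tangentialPart {p : ℝ≥0∞} {μ : Measure (EuclideanSpace ℝ (Fin n))}
    (hw : MemLp w p μ) : MemLp (tangentialPart w) p μ := by
  refine hw.mono ?_ (Filter.Eventually.of_forall (norm_tangentialPart_le w))
  have hwm : AEMeasurable w μ := hw.1.aemeasurable
  have hwi : ∀ i, AEMeasurable (fun x => w x i) μ := fun i =>
    (PiLp.proj (𝕜 := ℝ) 2 (fun _ : Fin n => EuclideanSpace ℝ (Fin N)) i).continuous.measurable.comp_aemeasurable hwm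
  refine AEMeasurable.aestronglyMeasurable ?_
  refine (WithLp.measurable_toLp 2 _).comp_aemeasurable (aemeasurable_pi_lambda _ fun i => ?_)
  have hxi : ∀ i, Measurable fun x : EuclideanSpace ℝ (Fin n) => x i := fun i => by fun_prop
  refine (hwi i).sub (AEMeasurable.smul ((hxi i).div (by fun_prop)).aemeasurable ?_)
  exact Finset.aemeasurable_fun_sum _ fun j _ => (hxi j).aemeasurable.smul (hwi j)

variable {u : EuclideanSpace ℝ (Fin n) → EuclideanSpace ℝ (Fin N)} {ρ σ : ℝ}

theorem IsWeakGradient.ae_isWeakTangentialGradient [Nontrivial (EuclideanSpace ℝ (Fin n))]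
    (hρ : 0 ≤ ρ) (h : IsWeakGradient (shell n ρ σ) u w)
    (hu : IntegrableOn u (shell n ρ σ)) (hw : IntegrableOn w (shell n ρ σ)) :
    ∀ᵐ r ∂(volume.restrict (Ioo ρ σ)), IsWeakTangentialGradient r u (tangentialPart w) := by
  have hu' := ae_memLp_sphereMeasure hρ one_ne_zero (memLp_one_iff_integrable.2 hu)
  have hw' := ae_memLp_sphereMeasure hρ one_ne_zero (memLp_one_iff_integrable.2 hw)
  filter_upwards [h.ae_forall_integral_divergencePairing_eq_zero hρ hu hw, hu', hw',
    ae_restrict_mem measurableSet_Ioo] with r hr hur hwr hrm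
  rw [memLp_one_iff_integrable] at hur hwr
  refine ⟨Filter.Eventually.of_forall (sum_smul_tangentialPart w), fun X hX hXt => ?_⟩
  have hnorm : ∀ᵐ x ∂(sphereMeasure n r), ‖x‖ ≤ r :=
    (ae_sphereMeasure_norm (hρ.trans_lt hrm.1)).mono fun x hx => hx.le
  have h0 : Integrable (0 : EuclideanSpace ℝ (Fin n) → GradSpace n N) (sphereMeasure n r) :=
    integrable_zero _ _ _
  have h0' : Integrable (0 : EuclideanSpace ℝ (Fin n) → EuclideanSpace ℝ (Fin N))
    (sphereMeasure n r) := integrable_zero _ _ _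
  have hi1 : Integrable (fun x => divergence X x • u x) (sphereMeasure n r) :=
    (integrable_divergencePairing hnorm hX hur h0).congr
      (Filter.Eventually.of_forall fun x => by simp [divergencePairing])
  have hi2 : Integrable (fun x => ∑ i, X x i • w x i) (sphereMeasure n r) :=
    (integrable_divergencePairing hnorm hX h0' hwr).congr
      (Filter.Eventually.of_forall fun x => by simp [divergencePairing])
  have e : ∀ x, ∑ i, X x i • tangentialPart w x i = ∑ i, X x i • w x i := fun x =>
    sum_smul_tangentialPart_of_inner_eq_zero w x (hXt x)
  simp only [e]
  rw [eq_neg_iff_add_eq_zero, ← hr X hX hXt]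
  exact (integral_add hi1 hi2).symm

end TangentialPart

/-! ### Rescaling from `∂B_r` to the unit sphere. -/

section Scaling

variable {n N : ℕ} {r : ℝ} {u : EuclideanSpace ℝ (Fin n) → EuclideanSpace ℝ (Fin N)}
  {w : EuclideanSpace ℝ (Fin n) → GradSpace n N}

theorem memLp_sphereMeasure_iff {F : Type*} [NormedAddCommGroup F] {p : ℝ≥0∞} (hr : 0 < r)
    {f : EuclideanSpace ℝ (Fin n) → F} :
    MemLp f p (sphereMeasure n r) ↔ MemLp (fun y => f (r • y)) p (sphereMeasure n 1) := by
  have h0 : ENNReal.ofReal (r ^ (n - 1)) ≠ 0 := by simp; positivity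
  have hc : ENNReal.ofReal (r ^ (n - 1)) ^ (1 / p).toReal ≠ 0 := by
    simp [ENNReal.rpow_eq_zero_iff, h0]
  have hc' : ENNReal.ofReal (r ^ (n - 1)) ^ (1 / p).toReal ≠ ⊤ := by
    simp [ENNReal.rpow_eq_top_iff, h0]
  rw [MemLp, MemLp, aestronglyMeasurable_sphereMeasure_iff hr, eLpNorm_sphereMeasure hr]
  refine and_congr_right fun _ => ⟨fun h => ?_, fun h => ENNReal.mul_lt_top hc'.lt_top h⟩
  exact ENNReal.lt_top_of_mul_ne_top_right h.ne hc

theorem IsWeakTangentialGradient.congr_ae {u' : EuclideanSpace ℝ (Fin n) → EuclideanSpace ℝ (Fin N)}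
    {w' : EuclideanSpace ℝ (Fin n) → GradSpace n N} (h : IsWeakTangentialGradient r u w)
    (hu : u =ᵐ[sphereMeasure n r] u') (hw : w =ᵐ[sphereMeasure n r] w') :
    IsWeakTangentialGradient r u' w' := by
  refine ⟨?_, fun X hX hXt => ?_⟩
  · filter_upwards [h.1, hw] with x hx hx'
    rw [← hx']; exact hx
  · rw [← integral_congr_ae (hu.mono fun x hx => ?_), h.2 X hX hXt,
      integral_congr_ae (hw.mono fun x hx => ?_)]
    · beta_reduce; rw [hx]
    · beta_reduce; rw [hx]

theorem divergence_comp_smul {X : EuclideanSpace ℝ (Fin n) → EuclideanSpace ℝ (Fin n)}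
    (y : EuclideanSpace ℝ (Fin n)) :
    divergence (fun y => X (r • y)) y = r * divergence X (r • y) := by
  simp only [divergence, Finset.mul_sum]
  refine Finset.sum_congr rfl fun i _ => ?_
  rw [fderiv_comp_smul]
  simp

/-- Fields are rescaled along with the maps; the chain rule puts the same factor `r` on both sides
of the formula. -/
theorem isWeakTangentialGradient_iff_comp_smul (hr : 0 < r) :
    IsWeakTangentialGradient r u w
      ↔ IsWeakTangentialGradient 1 (fun y => u (r • y)) (fun y => r • w (r • y)) := by
  have key : ∀ X : EuclideanSpace ℝ (Fin n) → EuclideanSpace ℝ (Fin n),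
      (∫ x, divergence X x • u x ∂(sphereMeasure n r)
        = - ∫ x, ∑ i, X x i • w x i ∂(sphereMeasure n r)) ↔
      (∫ y, divergence (fun y => X (r • y)) y • u (r • y) ∂(sphereMeasure n 1)
        = - ∫ y, ∑ i, X (r • y) i • (r • w (r • y)) i ∂(sphereMeasure n 1)) := by
    intro X
    have e1 : ∀ y, divergence (fun y => X (r • y)) y • u (r • y)
        = r • (divergence X (r • y) • u (r • y)) := fun y => by
      rw [divergence_comp_smul, mul_smul]
    have e2 : ∀ y, ∑ i, X (r • y) i • (r • w (r • y)) i
        = r • ∑ i, X (r • y) i • w (r • y) i := fun y => by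
      rw [Finset.smul_sum]
      refine Finset.sum_congr rfl fun i _ => ?_
      rw [PiLp.smul_apply, smul_comm]
    simp only [e1, e2]
    rw [integral_sphereMeasure hr, integral_sphereMeasure hr, integral_smul, integral_smul,
      ← smul_neg, ← smul_neg, smul_right_inj (by positivity), smul_right_inj hr.ne']
  refine and_congr ?_ ⟨fun h X hX hXt => ?_, fun h X hX hXt => ?_⟩
  · rw [ae_sphereMeasure_iff hr]
    refine Filter.eventually_congr (Filter.Eventually.of_forall fun y => ?_)
    have : ∑ i, (r • y) i • w (r • y) i = ∑ i, y i • (r • w (r • y)) i :=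
      Finset.sum_congr rfl fun i _ => by
        simp only [PiLp.smul_apply, smul_smul, smul_eq_mul, mul_comm]
    rw [this]
  · have h1 := (key fun x => X (r⁻¹ • x)).1 (h _ (hX.comp (contDiff_const_smul r⁻¹)) fun x => ?_)
    · simp only [smul_smul r⁻¹ r, inv_mul_cancel₀ hr.ne', one_smul] at h1
      exact h1
    · have h2 := hXt (r⁻¹ • x)
      rw [inner_smul_right] at h2
      exact (mul_eq_zero.1 h2).resolve_left (inv_ne_zero hr.ne')
  · refine (key X).2 (h _ (hX.comp (contDiff_const_smul _)) fun x => ?_)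
    have h2 := hXt (r • x)
    rw [inner_smul_right] at h2
    exact (mul_eq_zero.1 h2).resolve_left hr.ne'

theorem eLpNorm_sphere_cost_eq (p : ℝ≥0∞) (hr : 0 < r) (t : ℝ)
    (v v₂ : EuclideanSpace ℝ (Fin n) → EuclideanSpace ℝ (Fin N))
    (g : EuclideanSpace ℝ (Fin n) → GradSpace n N) :
    eLpNorm (v - v₂) p (sphereMeasure n r) + ENNReal.ofReal t *
        (eLpNorm v₂ p (sphereMeasure n r) + eLpNorm g p (sphereMeasure n r))
      = ENNReal.ofReal (r ^ (n - 1)) ^ (1 / p).toReal *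
        (eLpNorm (fun y => v (r • y) - v₂ (r • y)) p (sphereMeasure n 1) + ENNReal.ofReal t *
            (eLpNorm (fun y => v₂ (r • y)) p (sphereMeasure n 1)
              + ENNReal.ofReal r⁻¹ * eLpNorm (fun y => r • g (r • y)) p (sphereMeasure n 1))) := by
  have hri : ‖r⁻¹‖ₑ = ENNReal.ofReal r⁻¹ := Real.enorm_of_nonneg (by positivity)
  have hg : eLpNorm (fun y => g (r • y)) p (sphereMeasure n 1)
      = ENNReal.ofReal r⁻¹ * eLpNorm (fun y => r • g (r • y)) p (sphereMeasure n 1) := by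
    rw [← hri, ← eLpNorm_const_smul]
    congr 1
    funext y
    simp [smul_smul, inv_mul_cancel₀ hr.ne']
  rw [eLpNorm_sphereMeasure hr, eLpNorm_sphereMeasure hr, eLpNorm_sphereMeasure hr, ← hg]
  simp only [Pi.sub_apply]
  ring

/-- The competitors no longer depend on `r`, which survives only in `v(r ·)`, the prefactor and the
weight `r⁻¹` of the gradient. -/
theorem kFunctional_sphere_eq {p : ℝ≥0∞} {v : EuclideanSpace ℝ (Fin n) → EuclideanSpace ℝ (Fin N)}
    (hr : 0 < r) (hv : MemLp v p (sphereMeasure n r)) {t : ℝ} (ht : 0 < t) :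
    kFunctional (sphereMeasure n r) (IsWeakTangentialGradient r) p v t
      = ENNReal.ofReal (r ^ (n - 1)) ^ (1 / p).toReal *
        ⨅ (v₂ : EuclideanSpace ℝ (Fin n) → EuclideanSpace ℝ (Fin N))
          (g : EuclideanSpace ℝ (Fin n) → GradSpace n N)
          (_ : MemLp v₂ p (sphereMeasure n 1) ∧ MemLp g p (sphereMeasure n 1) ∧
            IsWeakTangentialGradient 1 v₂ g),
          (eLpNorm (fun y => v (r • y) - v₂ y) p (sphereMeasure n 1) + ENNReal.ofReal t *
            (eLpNorm v₂ p (sphereMeasure n 1)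
              + ENNReal.ofReal r⁻¹ * eLpNorm g p (sphereMeasure n 1))) := by
  have h0 : ENNReal.ofReal (r ^ (n - 1)) ≠ 0 := by simp; positivity
  have hc : ENNReal.ofReal (r ^ (n - 1)) ^ (1 / p).toReal ≠ 0 := by
    simp [ENNReal.rpow_eq_zero_iff, h0]
  have hc' : ENNReal.ofReal (r ^ (n - 1)) ^ (1 / p).toReal ≠ ⊤ := by
    simp [ENNReal.rpow_eq_top_iff, h0]
  rw [kFunctional_eq_iInf hv ht]
  simp only [ENNReal.mul_iInf_of_ne hc hc']
  refine le_antisymm (le_iInf₂ fun v₂ g => le_iInf fun h => ?_)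
    (le_iInf₂ fun v₂ g => le_iInf fun h => ?_)
  · have e1 : ∀ y : EuclideanSpace ℝ (Fin n), r⁻¹ • r • y = y := fun y => by
      rw [smul_smul, inv_mul_cancel₀ hr.ne', one_smul]
    have e2 : (fun y : EuclideanSpace ℝ (Fin n) => r • (r⁻¹ • g (r⁻¹ • r • y))) = g := by
      funext y
      rw [e1, smul_smul, mul_inv_cancel₀ hr.ne', one_smul]
    have h1 : MemLp (fun x => v₂ (r⁻¹ • x)) p (sphereMeasure n r) := by
      rw [memLp_sphereMeasure_iff hr]; simpa only [e1] using h.1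
    have h2 : MemLp (fun x => r⁻¹ • g (r⁻¹ • x)) p (sphereMeasure n r) := by
      rw [memLp_sphereMeasure_iff hr]; simp only [e1]; exact h.2.1.const_smul r⁻¹
    have h3 : IsWeakTangentialGradient r (fun x => v₂ (r⁻¹ • x)) fun x => r⁻¹ • g (r⁻¹ • x) := by
      rw [isWeakTangentialGradient_iff_comp_smul hr, e2]; simpa only [e1] using h.2.2
    refine (iInf₂_le (fun x => v₂ (r⁻¹ • x)) (fun x => r⁻¹ • g (r⁻¹ • x))).trans
      ((iInf_le _ ⟨h1, h2, h3⟩).trans_eq ?_)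
    rw [eLpNorm_sphere_cost_eq p hr, e2]
    simp only [e1]
  · rw [eLpNorm_sphere_cost_eq p hr]
    have h1 : MemLp (fun y => v₂ (r • y)) p (sphereMeasure n 1) :=
      (memLp_sphereMeasure_iff hr).1 h.1
    have h2 : MemLp (fun y => g (r • y)) p (sphereMeasure n 1) :=
      (memLp_sphereMeasure_iff hr).1 h.2.1
    have h3 : MemLp (fun y => r • g (r • y)) p (sphereMeasure n 1) := h2.const_smul r
    have h4 := (isWeakTangentialGradient_iff_comp_smul hr).1 h.2.2
    refine (iInf₂_le (fun x => v₂ (r • x)) (fun x => r • g (r • x))).trans ?_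
    exact iInf_le_of_le ⟨h1, h3, h4⟩ le_rfl

end Scaling

/-! ### Distance to Sobolev balls and its measurability for finite `p`. -/

section SobolevBall

variable {n N : ℕ}

/-- Couples of a map on the unit sphere with `L^p` norm at most `y` and a weak tangential
gradient with `L^p` norm at most `z`. -/
def IsSobolevPair (p y z : ℝ≥0∞) (v : EuclideanSpace ℝ (Fin n) → EuclideanSpace ℝ (Fin N))
    (g : EuclideanSpace ℝ (Fin n) → GradSpace n N) : Prop :=
  (MemLp v p (sphereMeasure n 1) ∧ MemLp g p (sphereMeasure n 1) ∧ IsWeakTangentialGradient 1 v g) ∧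
    eLpNorm v p (sphereMeasure n 1) ≤ y ∧ eLpNorm g p (sphereMeasure n 1) ≤ z

theorem IsSobolevPair.congr_ae {p y z : ℝ≥0∞}
    {v v' : EuclideanSpace ℝ (Fin n) → EuclideanSpace ℝ (Fin N)}
    {g g' : EuclideanSpace ℝ (Fin n) → GradSpace n N} (h : IsSobolevPair p y z v g)
    (hv : v =ᵐ[sphereMeasure n 1] v') (hg : g =ᵐ[sphereMeasure n 1] g') :
    IsSobolevPair p y z v' g' :=
  ⟨⟨(memLp_congr_ae hv).1 h.1.1, (memLp_congr_ae hg).1 h.1.2.1, h.1.2.2.congr_ae hv hg⟩,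
    (eLpNorm_congr_ae hv).symm.trans_le h.2.1, (eLpNorm_congr_ae hg).symm.trans_le h.2.2⟩

/-- The `L^p` distance of `f` to the Sobolev maps on the unit sphere with prescribed bounds. -/
noncomputable def sobolevBallDist (p y z : ℝ≥0∞)
    (f : EuclideanSpace ℝ (Fin n) → EuclideanSpace ℝ (Fin N)) : ℝ≥0∞ :=
  ⨅ (v : EuclideanSpace ℝ (Fin n) → EuclideanSpace ℝ (Fin N))
    (g : EuclideanSpace ℝ (Fin n) → GradSpace n N) (_ : IsSobolevPair p y z v g),
    eLpNorm (f - v) p (sphereMeasure n 1)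

/-- Competitors are sorted by rational upper bounds of their two norms, chosen arbitrarily close.
The index set is countable and free of `r` and `t`. Negative rationals act as the bound `0`. -/
theorem iInf_sobolev_eq_iInf_rat {p : ℝ≥0∞} (f : EuclideanSpace ℝ (Fin n) → EuclideanSpace ℝ (Fin N))
    (a b : ℝ) :
    (⨅ (v₂ : EuclideanSpace ℝ (Fin n) → EuclideanSpace ℝ (Fin N))
      (g : EuclideanSpace ℝ (Fin n) → GradSpace n N)
      (_ : MemLp v₂ p (sphereMeasure n 1) ∧ MemLp g p (sphereMeasure n 1) ∧
        IsWeakTangentialGradient 1 v₂ g),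
      (eLpNorm (f - v₂) p (sphereMeasure n 1) + ENNReal.ofReal a *
        (eLpNorm v₂ p (sphereMeasure n 1)
          + ENNReal.ofReal b * eLpNorm g p (sphereMeasure n 1))))
      = ⨅ (y : ℚ) (z : ℚ), (sobolevBallDist p (ENNReal.ofReal y) (ENNReal.ofReal z) f
        + ENNReal.ofReal a * (ENNReal.ofReal y + ENNReal.ofReal b * ENNReal.ofReal z)) := by
  refine le_antisymm (le_iInf₂ fun y z => ?_) (le_iInf₂ fun v g => le_iInf fun h => ?_)
  · simp only [sobolevBallDist, ENNReal.iInf_add]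
    refine le_iInf₂ fun v g => le_iInf fun h => (iInf₂_le v g).trans ((iInf_le _ h.1).trans ?_)
    gcongr
    exacts [h.2.1, h.2.2]
  · have hrat : ∀ c : ℝ≥0∞, c < ⊤ → ∀ δ : ℝ≥0∞, 0 < δ →
        ∃ y : ℚ, c ≤ ENNReal.ofReal y ∧ ENNReal.ofReal y ≤ c + δ := by
      intro c hc δ hδ
      obtain ⟨y, -, h1, h2⟩ := ENNReal.lt_iff_exists_rat_btwn.1
        (ENNReal.lt_add_right hc.ne hδ.ne')
      exact ⟨y, h1.le, h2.le⟩
    refine ENNReal.le_of_forall_pos_le_add fun ε hε _ => ?_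
    -- The error `ε / M` in both bounds costs at most `ε`; the summand `1` keeps `M` nonzero.
    set M : ℝ≥0∞ := ENNReal.ofReal a * (1 + ENNReal.ofReal b) + 1 with hM
    have hMt : M ≠ ⊤ := by simp [hM, ENNReal.mul_eq_top]
    have hM0 : M ≠ 0 := by simp [hM]
    have hδ : 0 < (ε : ℝ≥0∞) / M := ENNReal.div_pos (by simpa using hε.ne') hMt
    obtain ⟨y, hy1, hy2⟩ := hrat _ h.1.2 _ hδ
    obtain ⟨z, hz1, hz2⟩ := hrat _ h.2.1.2 _ hδ
    refine (iInf₂_le y z).trans ?_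
    have h1 : sobolevBallDist p (ENNReal.ofReal y) (ENNReal.ofReal z) f
        ≤ eLpNorm (f - v) p (sphereMeasure n 1) :=
      (iInf₂_le v g).trans (iInf_le _ ⟨h, hy1, hz1⟩)
    have h2 : ENNReal.ofReal a * (1 + ENNReal.ofReal b) * (ε / M) ≤ ε := by
      calc _ ≤ M * (ε / M) := by gcongr; exact le_self_add
        _ ≤ ε := ENNReal.mul_div_le
    calc _ ≤ eLpNorm (f - v) p (sphereMeasure n 1) + ENNReal.ofReal a *
          ((eLpNorm v p (sphereMeasure n 1) + ε / M)
            + ENNReal.ofReal b * (eLpNorm g p (sphereMeasure n 1) + ε / M)) := by gcongr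
      _ = (eLpNorm (f - v) p (sphereMeasure n 1) + ENNReal.ofReal a *
          (eLpNorm v p (sphereMeasure n 1) + ENNReal.ofReal b * eLpNorm g p (sphereMeasure n 1)))
          + ENNReal.ofReal a * (1 + ENNReal.ofReal b) * (ε / M) := by ring
      _ ≤ _ := by gcongr

/-- Distances to subsets of `L^p` can be computed along countably many measurable functions. -/
theorem exists_countable_iInf_eLpNorm_sub {p : ℝ≥0∞} [Fact (1 ≤ p)] (hp : p ≠ ⊤)
    (S : Set (Lp (EuclideanSpace ℝ (Fin N)) p (sphereMeasure n 1))) :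
    ∃ T : Set (EuclideanSpace ℝ (Fin n) → EuclideanSpace ℝ (Fin N)), T.Countable ∧
      (∀ φ ∈ T, StronglyMeasurable φ) ∧
      ∀ f (hf : MemLp f p (sphereMeasure n 1)), (⨅ φ ∈ T, eLpNorm (f - φ) p (sphereMeasure n 1))
        = Metric.infEDist (hf.toLp f) S := by
  have : Fact (p ≠ ⊤) := ⟨hp⟩
  obtain ⟨t, htS, htc, hSt⟩ :=
    (TopologicalSpace.IsSeparable.of_separableSpace S).exists_countable_dense_subset
  refine ⟨(fun h : Lp (EuclideanSpace ℝ (Fin N)) p (sphereMeasure n 1) =>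
    (h : EuclideanSpace ℝ (Fin n) → EuclideanSpace ℝ (Fin N))) '' t, htc.image _, ?_, fun f hf => ?_⟩
  · rintro _ ⟨h, -, rfl⟩
    exact Lp.stronglyMeasurable h
  · have e1 : Metric.infEDist (hf.toLp f) S = Metric.infEDist (hf.toLp f) t :=
      le_antisymm (Metric.infEDist_anti htS)
        (Metric.infEDist_closure.symm.trans_le (Metric.infEDist_anti hSt))
    rw [e1, Metric.infEDist, iInf_image]
    refine iInf_congr fun h => iInf_congr fun _ => ?_
    rw [Lp.edist_def]
    refine eLpNorm_congr_ae ?_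
    filter_upwards [hf.coeFn_toLp] with x hx
    simp [hx]

theorem measurable_iInf_eLpNorm_sub_comp_smul {p : ℝ≥0∞}
    {T : Set (EuclideanSpace ℝ (Fin n) → EuclideanSpace ℝ (Fin N))} (hTc : T.Countable)
    (hT : ∀ φ ∈ T, StronglyMeasurable φ)
    {V : EuclideanSpace ℝ (Fin n) → EuclideanSpace ℝ (Fin N)} (hV : StronglyMeasurable V) :
    Measurable fun r : ℝ =>
      ⨅ φ ∈ T, eLpNorm ((fun y => V (r • y)) - φ) p (sphereMeasure n 1) := by
  refine Measurable.biInf T hTc fun φ hφ => measurable_eLpNorm_of_measurable_enorm p _ ?_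
  exact ((hV.comp_measurable (by fun_prop)).sub ((hT φ hφ).comp_measurable measurable_snd)).enorm

theorem exists_measurable_sobolevBallDist_of_ne_top {p : ℝ≥0∞} (h1p : 1 ≤ p) (hp : p ≠ ⊤)
    (y z : ℝ≥0∞) {V : EuclideanSpace ℝ (Fin n) → EuclideanSpace ℝ (Fin N)}
    (hV : StronglyMeasurable V) :
    ∃ m : ℝ → ℝ≥0∞, Measurable m ∧ ∀ r, MemLp (fun y => V (r • y)) p (sphereMeasure n 1) →
      sobolevBallDist p y z (fun x => V (r • x)) = m r := by
  have : Fact (1 ≤ p) := ⟨h1p⟩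
  obtain ⟨T, hTc, hT, hTd⟩ := exists_countable_iInf_eLpNorm_sub (n := n) (N := N) hp
    {h | ∃ g, IsSobolevPair p y z h g}
  refine ⟨_, measurable_iInf_eLpNorm_sub_comp_smul (p := p) hTc hT hV, fun r hr => ?_⟩
  rw [hTd _ hr, sobolevBallDist]
  refine le_antisymm ?_ ?_
  · refine le_iInf₂ fun h ⟨g, hg⟩ => (iInf₂_le _ g).trans ((iInf_le _ hg).trans_eq ?_)
    rw [Lp.edist_def]
    refine eLpNorm_congr_ae ?_
    filter_upwards [hr.coeFn_toLp] with x hx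
    simp [hx]
  · refine le_iInf₂ fun v g => le_iInf fun h => ?_
    refine (iInf₂_le (h.1.1.toLp v) ⟨g, h.congr_ae h.1.1.coeFn_toLp.symm (ae_eq_refl g)⟩).trans_eq ?_
    exact Lp.edist_toLp_toLp _ _ hr h.1.1

end SobolevBall

/-! ### Uniform bounds inside `L^p`. -/

section EssentiallyBounded

variable {α F : Type*} [MeasurableSpace α] {μ : Measure α} [NormedAddCommGroup F]

theorem eLpNorm_top_le_coe_iff {f : α → F} {c : ℝ≥0} :
    eLpNorm f ⊤ μ ≤ c ↔ ∀ᵐ x ∂μ, ‖f x‖ ≤ c := by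
  rw [eLpNorm_exponent_top]
  refine ⟨fun h => ?_, fun h => ?_⟩
  · filter_upwards [enorm_ae_le_eLpNormEssSup f μ] with x hx
    have := hx.trans h
    rwa [enorm_le_coe] at this
  · refine essSup_le_of_ae_le _ ?_
    filter_upwards [h] with x hx
    rwa [enorm_le_coe]

theorem exists_subseq_tendsto_ae {p : ℝ≥0∞} [Fact (1 ≤ p)] {h : ℕ → Lp F p μ} {h' : Lp F p μ}
    (hlim : Filter.Tendsto h Filter.atTop (nhds h')) :
    ∃ ns : ℕ → ℕ, StrictMono ns ∧
      ∀ᵐ x ∂μ, Filter.Tendsto (fun k => h (ns k) x) Filter.atTop (nhds (h' x)) :=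
  (tendstoInMeasure_of_tendsto_Lp hlim).exists_seq_tendsto_ae

theorem isClosed_setOf_ae_norm_le {p : ℝ≥0∞} [Fact (1 ≤ p)] (c : ℝ) :
    IsClosed {h : Lp F p μ | ∀ᵐ x ∂μ, ‖h x‖ ≤ c} := by
  refine IsSeqClosed.isClosed fun h h' hmem hlim => ?_
  obtain ⟨ns, -, hns⟩ := exists_subseq_tendsto_ae hlim
  filter_upwards [hns, ae_all_iff.2 fun k => hmem (ns k)] with x hx hx'
  exact le_of_tendsto' hx.norm hx'

theorem convex_setOf_ae_norm_le [NormedSpace ℝ F] {p : ℝ≥0∞} [Fact (1 ≤ p)] (c : ℝ) :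
    Convex ℝ {h : Lp F p μ | ∀ᵐ x ∂μ, ‖h x‖ ≤ c} := by
  intro f hf g hg a b ha hb hab
  filter_upwards [hf, hg, Lp.coeFn_add (a • f) (b • g), Lp.coeFn_smul a f, Lp.coeFn_smul b g]
    with x h1 h2 h3 h4 h5
  rw [h3, Pi.add_apply, h4, h5]
  have := convex_closedBall (0 : F) c (x := f x) (by simpa using h1) (y := g x) (by simpa using h2)
    ha hb hab
  simpa using this

end EssentiallyBounded

/-! ### Linearity and closedness of the weak tangential gradient. -/

section WeakTangentialGradient

variable {n N : ℕ} {r : ℝ}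

theorem IsWeakTangentialGradient.linear_combination (hr : 0 < r)
    {u u' : EuclideanSpace ℝ (Fin n) → EuclideanSpace ℝ (Fin N)}
    {w w' : EuclideanSpace ℝ (Fin n) → GradSpace n N}
    (h : IsWeakTangentialGradient r u w) (h' : IsWeakTangentialGradient r u' w')
    (hu : Integrable u (sphereMeasure n r)) (hu' : Integrable u' (sphereMeasure n r))
    (hw : Integrable w (sphereMeasure n r)) (hw' : Integrable w' (sphereMeasure n r)) (a b : ℝ) :
    IsWeakTangentialGradient r (fun x => a • u x + b • u' x) (fun x => a • w x + b • w' x) := by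
  have hsum : ∀ c x : EuclideanSpace ℝ (Fin n), ∑ i, c i • (a • w x + b • w' x) i
      = a • ∑ i, c i • w x i + b • ∑ i, c i • w' x i := fun c x => by
    simp only [PiLp.add_apply, PiLp.smul_apply, smul_add, Finset.sum_add_distrib, Finset.smul_sum,
      smul_comm a, smul_comm b]
  refine ⟨?_, fun X hX hXt => ?_⟩
  · filter_upwards [h.1, h'.1] with x h1 h2
    rw [hsum, h1, h2, smul_zero, smul_zero, add_zero]
  have hnorm : ∀ᵐ x ∂(sphereMeasure n r), ‖x‖ ≤ r := (ae_sphereMeasure_norm hr).mono fun x => le_of_eq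
  have hd : ∀ {u : EuclideanSpace ℝ (Fin n) → EuclideanSpace ℝ (Fin N)},
      Integrable u (sphereMeasure n r) → Integrable (fun x => divergence X x • u x)
        (sphereMeasure n r) := fun hu =>
    (integrable_divergencePairing hnorm hX hu (integrable_zero _ (GradSpace n N) _)).congr
      (Filter.Eventually.of_forall fun x => by simp [divergencePairing])
  have hp : ∀ {w : EuclideanSpace ℝ (Fin n) → GradSpace n N},
      Integrable w (sphereMeasure n r) → Integrable (fun x => ∑ i, X x i • w x i)
        (sphereMeasure n r) := fun hw =>
    (integrable_divergencePairing hnorm hX (integrable_zero _ (EuclideanSpace ℝ (Fin N)) _) hw).congr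
      (Filter.Eventually.of_forall fun x => by simp [divergencePairing])
  have e1 : ∀ x, divergence X x • (a • u x + b • u' x)
      = a • (divergence X x • u x) + b • (divergence X x • u' x) := fun x => by
    rw [smul_add, smul_comm, smul_comm _ b]
  change ∫ x, divergence X x • (a • u x + b • u' x) ∂(sphereMeasure n r) = _
  simp only [e1, hsum]
  have hlin : ∀ f g : EuclideanSpace ℝ (Fin n) → EuclideanSpace ℝ (Fin N),
      Integrable f (sphereMeasure n r) → Integrable g (sphereMeasure n r) →
      ∫ x, (a • f x + b • g x) ∂(sphereMeasure n r)
        = a • ∫ x, f x ∂(sphereMeasure n r) + b • ∫ x, g x ∂(sphereMeasure n r) := by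
    intro f g hf hg
    rw [← integral_smul, ← integral_smul]
    exact integral_add (hf.smul a) (hg.smul b)
  rw [hlin _ _ (hd hu) (hd hu'), hlin _ _ (hp hw) (hp hw'), neg_add, ← smul_neg, ← smul_neg]
  exact congrArg₂ (fun y z => a • y + b • z) (h.2 X hX hXt) (h'.2 X hX hXt)

/-- Dominated convergence: the sphere has finite measure, and the uniform bounds together with those
of `X` and its divergence on the closed ball give a constant majorant. -/
theorem isWeakTangentialGradient_of_tendsto_ae (hr : 0 < r)
    {u : ℕ → EuclideanSpace ℝ (Fin n) → EuclideanSpace ℝ (Fin N)}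
    {u' : EuclideanSpace ℝ (Fin n) → EuclideanSpace ℝ (Fin N)}
    {w : ℕ → EuclideanSpace ℝ (Fin n) → GradSpace n N}
    {w' : EuclideanSpace ℝ (Fin n) → GradSpace n N} {y z : ℝ}
    (h : ∀ k, IsWeakTangentialGradient r (u k) (w k))
    (hum : ∀ k, AEStronglyMeasurable (u k) (sphereMeasure n r))
    (hwm : ∀ k, AEStronglyMeasurable (w k) (sphereMeasure n r))
    (hub : ∀ k, ∀ᵐ x ∂(sphereMeasure n r), ‖u k x‖ ≤ y)
    (hwb : ∀ k, ∀ᵐ x ∂(sphereMeasure n r), ‖w k x‖ ≤ z)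
    (hu : ∀ᵐ x ∂(sphereMeasure n r), Filter.Tendsto (fun k => u k x) Filter.atTop (nhds (u' x)))
    (hw : ∀ᵐ x ∂(sphereMeasure n r), Filter.Tendsto (fun k => w k x) Filter.atTop (nhds (w' x))) :
    IsWeakTangentialGradient r u' w' := by
  have hproj : ∀ᵐ x ∂(sphereMeasure n r), ∀ c : EuclideanSpace ℝ (Fin n),
      Filter.Tendsto (fun k => ∑ i, c i • w k x i) Filter.atTop (nhds (∑ i, c i • w' x i)) := by
    filter_upwards [hw] with x hx c
    have hc : Continuous fun g : GradSpace n N => ∑ i, c i • g i := by fun_prop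
    exact (hc.tendsto _).comp hx
  refine ⟨?_, fun X hX hXt => ?_⟩
  · filter_upwards [hproj, ae_all_iff.2 fun k => (h k).1] with x hx hx'
    refine tendsto_nhds_unique (hx x) ?_
    simp only [hx']
    exact tendsto_const_nhds
  have hnorm : ∀ᵐ x ∂(sphereMeasure n r), ‖x‖ ≤ r := (ae_sphereMeasure_norm hr).mono fun x => le_of_eq
  have hmeas : ∀ c : ℝ, Integrable (fun _ : EuclideanSpace ℝ (Fin n) => c) (sphereMeasure n r) :=
    integrable_const
  have hXm : ∀ i, Continuous fun x => X x i := fun i => by have := hX.continuous; fun_prop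
  have hwi : ∀ k i, AEStronglyMeasurable (fun x => w k x i) (sphereMeasure n r) := fun k i =>
    (PiLp.proj (𝕜 := ℝ) 2 (fun _ : Fin n => EuclideanSpace ℝ (Fin N)) i).continuous.comp_aestronglyMeasurable (hwm k)
  obtain ⟨C, hC⟩ := (isCompact_closedBall (0 : EuclideanSpace ℝ (Fin n)) r).exists_bound_of_continuousOn
    (continuous_divergence hX).continuousOn
  obtain ⟨C', hC'⟩ := (isCompact_closedBall (0 : EuclideanSpace ℝ (Fin n)) r).exists_bound_of_continuousOn
    hX.continuous.continuousOn
  have l1 : Filter.Tendsto (fun k => ∫ x, divergence X x • u k x ∂(sphereMeasure n r)) Filter.atTop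
      (nhds (∫ x, divergence X x • u' x ∂(sphereMeasure n r))) := by
    refine tendsto_integral_of_dominated_convergence (fun _ => C * y)
      (fun k => (continuous_divergence hX).aestronglyMeasurable.smul (hum k)) (hmeas _)
      (fun k => ?_) ?_
    · filter_upwards [hnorm, hub k] with x hx hx'
      rw [norm_smul]
      have := hC x (by simpa using hx)
      exact mul_le_mul this hx' (norm_nonneg _) ((norm_nonneg _).trans this)
    · filter_upwards [hu] with x hx using hx.const_smul _
  have l2 : Filter.Tendsto (fun k => - ∫ x, ∑ i, X x i • w k x i ∂(sphereMeasure n r)) Filter.atTop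
      (nhds (- ∫ x, ∑ i, X x i • w' x i ∂(sphereMeasure n r))) := by
    refine (tendsto_integral_of_dominated_convergence (fun _ => n * (C' * z))
      (fun k => Finset.aestronglyMeasurable_fun_sum _ fun i _ =>
        (hXm i).aestronglyMeasurable.smul (hwi k i)) (hmeas _) (fun k => ?_) ?_).neg
    · filter_upwards [hnorm, hwb k] with x hx hx'
      refine (norm_sum_le_of_le _ (f := fun i => X x i • w k x i) (n := fun _ => C' * z)
        fun i _ => ?_).trans_eq (by simp)
      rw [norm_smul]
      have h1 := (PiLp.norm_apply_le (X x) i).trans (hC' x (by simpa using hx))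
      have h2 := (PiLp.norm_apply_le (w k x) i).trans hx'
      exact mul_le_mul h1 h2 (norm_nonneg _) ((norm_nonneg _).trans h1)
    · filter_upwards [hproj] with x hx using hx _
  exact tendsto_nhds_unique l1 (l2.congr fun k => ((h k).2 X hX hXt).symm)

end WeakTangentialGradient

/-! ### The case `p = ∞`, treated in `L²`. -/

section BoundedPairs

variable {n N : ℕ}

/-- The essentially bounded Sobolev pairs, as a subset of a Hilbert space. -/
def sobolevPairs (n N : ℕ) (y z : ℝ) :
    Set (WithLp 2 (Lp (EuclideanSpace ℝ (Fin N)) 2 (sphereMeasure n 1)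
      × Lp (GradSpace n N) 2 (sphereMeasure n 1))) :=
  {c | (∀ᵐ x ∂(sphereMeasure n 1), ‖c.fst x‖ ≤ y) ∧ (∀ᵐ x ∂(sphereMeasure n 1), ‖c.snd x‖ ≤ z) ∧
    IsWeakTangentialGradient 1 c.fst c.snd}

theorem isClosed_sobolevPairs (y z : ℝ) : IsClosed (sobolevPairs n N y z) := by
  refine IsSeqClosed.isClosed fun c c' hmem hlim => ?_
  have hcont : Continuous fun c : WithLp 2 (Lp (EuclideanSpace ℝ (Fin N)) 2 (sphereMeasure n 1)
      × Lp (GradSpace n N) 2 (sphereMeasure n 1)) => (c.fst, c.snd) :=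
    WithLp.prod_continuous_ofLp 2 _ _
  have h1 : Filter.Tendsto (fun k => (c k).fst) Filter.atTop (nhds c'.fst) :=
    ((continuous_fst.comp hcont).tendsto c').comp hlim
  have h2 : Filter.Tendsto (fun k => (c k).snd) Filter.atTop (nhds c'.snd) :=
    ((continuous_snd.comp hcont).tendsto c').comp hlim
  refine ⟨(isClosed_setOf_ae_norm_le y).mem_of_tendsto h1 (Filter.Eventually.of_forall fun k => (hmem k).1),
    (isClosed_setOf_ae_norm_le z).mem_of_tendsto h2 (Filter.Eventually.of_forall fun k => (hmem k).2.1), ?_⟩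
  -- A second extraction makes the maps and the gradients converge a.e. along the same subsequence.
  obtain ⟨ns, hns, hl1⟩ := exists_subseq_tendsto_ae h1
  obtain ⟨ms, hms, hl2⟩ := exists_subseq_tendsto_ae (h2.comp hns.tendsto_atTop)
  refine isWeakTangentialGradient_of_tendsto_ae one_pos (u := fun k => (c (ns (ms k))).fst)
    (w := fun k => (c (ns (ms k))).snd) (fun k => (hmem _).2.2) (fun k => Lp.aestronglyMeasurable _)
    (fun k => Lp.aestronglyMeasurable _) (fun k => (hmem _).1) (fun k => (hmem _).2.1) ?_ hl2
  filter_upwards [hl1] with x hx using hx.comp hms.tendsto_atTop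

theorem convex_sobolevPairs (y z : ℝ) : Convex ℝ (sobolevPairs n N y z) := by
  intro c hc c' hc' a b ha hb hab
  refine ⟨convex_setOf_ae_norm_le y hc.1 hc'.1 ha hb hab,
    convex_setOf_ae_norm_le z hc.2.1 hc'.2.1 ha hb hab, ?_⟩
  have hi : ∀ {F : Type} [NormedAddCommGroup F] (f : Lp F 2 (sphereMeasure n 1)),
      Integrable f (sphereMeasure n 1) := fun f => (Lp.memLp f).integrable (by norm_num)
  refine (hc.2.2.linear_combination one_pos hc'.2.2 (hi _) (hi _) (hi _) (hi _) a b).congr_ae ?_ ?_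
  · filter_upwards [Lp.coeFn_add (a • c.fst) (b • c'.fst), Lp.coeFn_smul a c.fst,
      Lp.coeFn_smul b c'.fst] with x h1 h2 h3
    rw [WithLp.add_fst, WithLp.smul_fst, WithLp.smul_fst, h1, Pi.add_apply, h2, h3]
    rfl
  · filter_upwards [Lp.coeFn_add (a • c.snd) (b • c'.snd), Lp.coeFn_smul a c.snd,
      Lp.coeFn_smul b c'.snd] with x h1 h2 h3
    rw [WithLp.add_snd, WithLp.smul_snd, WithLp.smul_snd, h1, Pi.add_apply, h2, h3]
    rfl

theorem WithLp.norm_le_add_norm {E F : Type*} [NormedAddCommGroup E] [NormedAddCommGroup F]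
    (c : WithLp 2 (E × F)) : ‖c‖ ≤ ‖c.fst‖ + ‖c.snd‖ := by
  rw [WithLp.prod_norm_eq_of_L2]
  refine Real.sqrt_le_iff.2 ⟨by positivity, ?_⟩
  nlinarith [norm_nonneg c.fst, norm_nonneg c.snd]

/-- The square integrable maps at uniform distance at most `x` from an essentially bounded
Sobolev map. -/
def sobolevNhd (n N : ℕ) (x y z : ℝ) : Set (Lp (EuclideanSpace ℝ (Fin N)) 2 (sphereMeasure n 1)) :=
  {f | ∃ f₁ : Lp (EuclideanSpace ℝ (Fin N)) 2 (sphereMeasure n 1), ∃ c ∈ sobolevPairs n N y z,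
    (∀ᵐ ξ ∂(sphereMeasure n 1), ‖f₁ ξ‖ ≤ x) ∧ f₁ + c.fst = f}

/-- A sum of two closed sets need not be closed; here it is the image under addition of a set of
triples in a Hilbert space that is closed, convex and bounded. -/
theorem isClosed_sobolevNhd {x y z : ℝ} (hx : 0 ≤ x) (hy : 0 ≤ y) (hz : 0 ≤ z) :
    IsClosed (sobolevNhd n N x y z) := by
  let A := Lp (EuclideanSpace ℝ (Fin N)) 2 (sphereMeasure n 1)
  let B := WithLp 2 (A × Lp (GradSpace n N) 2 (sphereMeasure n 1))
  let T : WithLp 2 (A × B) →L[ℝ] A :=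
    WithLp.fstL 2 ℝ A B + (WithLp.fstL 2 ℝ A (Lp (GradSpace n N) 2 (sphereMeasure n 1))).comp
      (WithLp.sndL 2 ℝ A B)
  set C : Set (WithLp 2 (A × B)) :=
    {c | (∀ᵐ ξ ∂(sphereMeasure n 1), ‖c.fst ξ‖ ≤ x) ∧ c.snd ∈ sobolevPairs n N y z} with hC
  have hCcl : IsClosed C :=
    ((isClosed_setOf_ae_norm_le x).preimage
      (continuous_fst.comp (WithLp.prod_continuous_ofLp 2 A B))).inter
    ((isClosed_sobolevPairs y z).preimage
      (continuous_snd.comp (WithLp.prod_continuous_ofLp 2 A B)))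
  have hCconv : Convex ℝ C := fun c hc c' hc' a b ha hb hab =>
    ⟨convex_setOf_ae_norm_le x hc.1 hc'.1 ha hb hab, convex_sobolevPairs y z hc.2 hc'.2 ha hb hab⟩
  have him : sobolevNhd n N x y z = T '' C := by
    ext f
    constructor
    · rintro ⟨f₁, c, hc, h1, rfl⟩
      exact ⟨WithLp.toLp 2 (f₁, c), ⟨h1, hc⟩, rfl⟩
    · rintro ⟨c, hc, rfl⟩
      exact ⟨c.fst, c.snd, hc.2, hc.1, rfl⟩
  rw [him]
  refine isClosed_image_of_convex_isClosed_bounded T hCcl hCconv fun c hc =>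
    (WithLp.norm_le_add_norm c).trans (add_le_add (Lp.norm_le_of_ae_bound hx hc.1)
      ((WithLp.norm_le_add_norm c.snd).trans (add_le_add (Lp.norm_le_of_ae_bound hy hc.2.1)
        (Lp.norm_le_of_ae_bound hz hc.2.2.1))))

theorem toLp_mem_sobolevNhd_iff {f : EuclideanSpace ℝ (Fin n) → EuclideanSpace ℝ (Fin N)}
    (hf : MemLp f 2 (sphereMeasure n 1)) {x y z : ℝ≥0} :
    hf.toLp f ∈ sobolevNhd n N x y z ↔
      ∃ v g, IsSobolevPair ⊤ y z v g ∧ eLpNorm (f - v) ⊤ (sphereMeasure n 1) ≤ x := by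
  constructor
  · rintro ⟨f₁, c, hc, h1, h2⟩
    refine ⟨c.fst, c.snd, ⟨⟨memLp_top_of_bound (Lp.aestronglyMeasurable _) y hc.1,
      memLp_top_of_bound (Lp.aestronglyMeasurable _) z hc.2.1, hc.2.2⟩,
      eLpNorm_top_le_coe_iff.2 hc.1, eLpNorm_top_le_coe_iff.2 hc.2.1⟩,
      eLpNorm_top_le_coe_iff.2 ?_⟩
    filter_upwards [h1, hf.coeFn_toLp, Lp.coeFn_add f₁ c.fst] with ξ e1 e2 e3
    rw [Pi.sub_apply, ← e2, ← h2, e3, Pi.add_apply, add_sub_cancel_right]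
    exact e1
  · rintro ⟨v, g, h, hfv⟩
    have hv2 : MemLp v 2 (sphereMeasure n 1) := h.1.1.mono_exponent le_top
    have hg2 : MemLp g 2 (sphereMeasure n 1) := h.1.2.1.mono_exponent le_top
    refine ⟨hf.toLp f - hv2.toLp v, WithLp.toLp 2 (hv2.toLp v, hg2.toLp g), ⟨?_, ?_, ?_⟩, ?_, ?_⟩
    · filter_upwards [hv2.coeFn_toLp, eLpNorm_top_le_coe_iff.1 h.2.1] with ξ e1 e2
      change ‖hv2.toLp v ξ‖ ≤ _
      rw [e1]; exact e2
    · filter_upwards [hg2.coeFn_toLp, eLpNorm_top_le_coe_iff.1 h.2.2] with ξ e1 e2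
      change ‖hg2.toLp g ξ‖ ≤ _
      rw [e1]; exact e2
    · exact h.1.2.2.congr_ae hv2.coeFn_toLp.symm hg2.coeFn_toLp.symm
    · filter_upwards [Lp.coeFn_sub (hf.toLp f) (hv2.toLp v), hf.coeFn_toLp, hv2.coeFn_toLp,
        eLpNorm_top_le_coe_iff.1 hfv] with ξ e1 e2 e3 e4
      rw [e1, Pi.sub_apply, e2, e3]; exact e4
    · exact sub_add_cancel _ _

/-- The distance is the infimum of the rationals `x` for which `v(r ·)` lies in the
`x`-neighbourhood of the Sobolev ball. That neighbourhood is closed in `L²`, so membership means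
zero `L²` distance, a countable infimum measurable in `r`. -/
theorem exists_measurable_sobolevBallDist_top (y z : ℝ≥0)
    {V : EuclideanSpace ℝ (Fin n) → EuclideanSpace ℝ (Fin N)} (hV : StronglyMeasurable V) :
    ∃ m : ℝ → ℝ≥0∞, Measurable m ∧ ∀ r, MemLp (fun y => V (r • y)) ⊤ (sphereMeasure n 1) →
      sobolevBallDist ⊤ y z (fun x => V (r • x)) = m r := by
  classical
  choose T hTc hT hTd using fun x : ℚ => exists_countable_iInf_eLpNorm_sub (p := 2) (by simp)
    (sobolevNhd n N (Real.toNNReal x) y z)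
  refine ⟨fun r => ⨅ x : ℚ, if (⨅ φ ∈ T x, eLpNorm ((fun y => V (r • y)) - φ) 2
    (sphereMeasure n 1)) = 0 then ENNReal.ofReal x else ⊤, ?_, fun r hr => ?_⟩
  · refine Measurable.iInf fun x => Measurable.ite ?_ measurable_const measurable_const
    exact measurable_iInf_eLpNorm_sub_comp_smul (hTc x) (hT x) hV (measurableSet_singleton 0)
  have hr2 : MemLp (fun y => V (r • y)) 2 (sphereMeasure n 1) := hr.mono_exponent le_top
  have hiff : ∀ x : ℚ, (⨅ φ ∈ T x, eLpNorm ((fun y => V (r • y)) - φ) 2 (sphereMeasure n 1)) = 0 ↔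
      ∃ v g, IsSobolevPair ⊤ y z v g ∧
        eLpNorm ((fun y => V (r • y)) - v) ⊤ (sphereMeasure n 1) ≤ ENNReal.ofReal x := by
    intro x
    rw [hTd x _ hr2, ← Metric.mem_closure_iff_infEDist_zero,
      (isClosed_sobolevNhd (NNReal.coe_nonneg _) (NNReal.coe_nonneg _)
        (NNReal.coe_nonneg _)).closure_eq]
    exact toLp_mem_sobolevNhd_iff hr2
  simp only [hiff]
  refine le_antisymm (le_iInf fun x => ?_) (le_iInf₂ fun v g => le_iInf fun h => ?_)
  · split_ifs with hx
    · obtain ⟨v, g, h, hvx⟩ := hx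
      exact (iInf₂_le v g).trans ((iInf_le _ h).trans hvx)
    · exact le_top
  · refine le_of_forall_gt fun b hb => ?_
    obtain ⟨x, -, h1, h2⟩ := ENNReal.lt_iff_exists_rat_btwn.1 hb
    refine (iInf_le _ x).trans_lt ?_
    rw [if_pos ⟨v, g, h, h1.le⟩]
    exact h2

theorem exists_measurable_sobolevBallDist {p : ℝ≥0∞} (h1p : 1 ≤ p) (y z : ℝ)
    {V : EuclideanSpace ℝ (Fin n) → EuclideanSpace ℝ (Fin N)} (hV : StronglyMeasurable V) :
    ∃ m : ℝ → ℝ≥0∞, Measurable m ∧ ∀ r, MemLp (fun y => V (r • y)) p (sphereMeasure n 1) →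
      sobolevBallDist p (ENNReal.ofReal y) (ENNReal.ofReal z) (fun x => V (r • x)) = m r := by
  by_cases hp : p = ⊤
  · subst hp
    exact exists_measurable_sobolevBallDist_top _ _ hV
  · exact exists_measurable_sobolevBallDist_of_ne_top h1p hp _ _ hV

end BoundedPairs

/-! ### Joint measurability of the spherical K-functional. -/

section Measurability

variable {n N : ℕ} [Nontrivial (EuclideanSpace ℝ (Fin n))] {ρ σ : ℝ}

/-- The exceptional radii come only from replacing `v` by a measurable representative and from its
integrability on spheres, so they do not depend on `t`. -/
theorem exists_measurable_kFunctional_sphere {p : ℝ≥0∞} (h1p : 1 ≤ p) (hρ : 0 ≤ ρ)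
    {v : EuclideanSpace ℝ (Fin n) → EuclideanSpace ℝ (Fin N)}
    (hv : MemLp v p (volume.restrict (shell n ρ σ))) :
    ∃ k : ℝ → ℝ → ℝ≥0∞, Measurable (fun z : ℝ × ℝ => k z.1 z.2) ∧
      ∀ᵐ r ∂(volume.restrict (Ioo ρ σ)), ∀ t > 0,
        kFunctional (sphereMeasure n r) (IsWeakTangentialGradient r) p v t = k r t := by
  choose m hm hmd using fun y z : ℚ => exists_measurable_sobolevBallDist (n := n) (N := N) h1p y z
    hv.1.stronglyMeasurable_mk
  refine ⟨fun r t => ENNReal.ofReal (r ^ (n - 1)) ^ (1 / p).toReal * ⨅ (y : ℚ) (z : ℚ),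
    (m y z r + ENNReal.ofReal t * (ENNReal.ofReal y + ENNReal.ofReal r⁻¹ * ENNReal.ofReal z)), ?_, ?_⟩
  · refine Measurable.mul (by fun_prop) (Measurable.iInf fun y => Measurable.iInf fun z => ?_)
    have : Measurable fun a : ℝ × ℝ => m y z a.1 := (hm y z).comp measurable_fst
    exact this.add (by fun_prop)
  filter_upwards [ae_ae_sphereMeasure hρ hv.1.ae_eq_mk, ae_memLp_sphereMeasure hρ
    (one_pos.trans_le h1p).ne' hv, ae_restrict_mem measurableSet_Ioo] with r hr hvr hrm t ht
  have hr0 : 0 < r := hρ.trans_lt hrm.1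
  have hV : MemLp (hv.1.mk v) p (sphereMeasure n r) := (memLp_congr_ae hr).1 hvr
  rw [kFunctional_congr hr, kFunctional_sphere_eq hr0 hV ht]
  congr 1
  refine (iInf_sobolev_eq_iInf_rat (fun y => hv.1.mk v (r • y)) t r⁻¹).trans ?_
  simp only [hmd _ _ r ((memLp_sphereMeasure_iff hr0).1 hV)]

end Measurability

/-! ### Norm inequalities for functions with values in `[0, ∞]`. -/

section ENNRealValued

theorem MeasureTheory.eLpNorm_const_mul_le {α : Type*} [MeasurableSpace α] {μ : Measure α}
    {c : ℝ≥0∞} (hc : c ≠ ⊤) (f : α → ℝ≥0∞) (p : ℝ≥0∞) :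
    eLpNorm (fun x => c * f x) p μ ≤ c * eLpNorm f p μ := by
  lift c to ℝ≥0 using hc
  exact eLpNorm_le_nnreal_smul_eLpNorm_of_ae_le_mul'
    (Filter.Eventually.of_forall fun x => by simp) p

theorem MeasureTheory.eLpNorm_le_of_ae_le_add_mul_add {α : Type*} [MeasurableSpace α]
    {μ : Measure α} {p c : ℝ≥0∞} (hp : 1 ≤ p) (hc : c ≠ ⊤) {f a₁ a₂ a₃ : α → ℝ≥0∞}
    (h₁ : AEMeasurable a₁ μ) (h₂ : AEMeasurable a₂ μ) (h₃ : AEMeasurable a₃ μ)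
    (h : ∀ᵐ x ∂μ, f x ≤ a₁ x + c * (a₂ x + a₃ x)) :
    eLpNorm f p μ ≤ eLpNorm a₁ p μ + c * (eLpNorm a₂ p μ + eLpNorm a₃ p μ) := by
  have h' : ∀ᵐ x ∂μ, ‖f x‖ₑ ≤ ‖(a₁ + fun x => c * (a₂ + a₃) x) x‖ₑ := h
  refine (eLpNorm_mono_enorm_ae h').trans ((eLpNorm_add_le h₁.aestronglyMeasurable
    ((h₂.add h₃).const_mul c).aestronglyMeasurable hp).trans ?_)
  gcongr
  refine (eLpNorm_const_mul_le hc _ p).trans ?_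
  gcongr
  exact eLpNorm_add_le h₂.aestronglyMeasurable h₃.aestronglyMeasurable hp

end ENNRealValued

/-! ### From K-functionals to Besov norms. -/

section Besov

variable {n N : ℕ} [Nontrivial (EuclideanSpace ℝ (Fin n))] {ρ σ : ℝ}

omit [Nontrivial (EuclideanSpace ℝ (Fin n))] in
theorem shell_subset_annulus : shell n ρ σ ⊆ annulus n ρ σ :=
  interior_maximal (fun x hx => ⟨by simpa using hx.2, by simpa using hx.1.le⟩) (isOpen_shell ρ σ)

instance isFiniteMeasure_restrict_shell :
    IsFiniteMeasure (volume.restrict (shell n ρ σ)) := by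
  refine isFiniteMeasure_restrict.2 (ne_top_of_le_ne_top
    (measure_ball_lt_top (x := (0 : EuclideanSpace ℝ (Fin n))) (r := σ)).ne
    (measure_mono fun x hx => ?_))
  simpa using hx.2

theorem eLpNorm_kFunctional_sphere_le {p : ℝ≥0∞} (h1p : 1 ≤ p) (hρ : 0 ≤ ρ)
    {v : EuclideanSpace ℝ (Fin n) → EuclideanSpace ℝ (Fin N)}
    (hv : MemLp v p (volume.restrict (annulus n ρ σ))) {t : ℝ} (ht : 0 < t) :
    eLpNorm (fun r => kFunctional (sphereMeasure n r) (IsWeakTangentialGradient r) p v t) p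
        (volume.restrict (Ioo ρ σ))
      ≤ kFunctional (volume.restrict (annulus n ρ σ)) (IsWeakGradient (annulus n ρ σ)) p v t := by
  have hp0 : p ≠ 0 := (one_pos.trans_le h1p).ne'
  have hle : volume.restrict (shell n ρ σ) ≤ volume.restrict (annulus n ρ σ) :=
    Measure.restrict_mono_set _ shell_subset_annulus
  rw [kFunctional_eq_iInf hv ht]
  -- The null set of radii depends on the competitor, harmlessly: the norm in `r` is bounded for one
  -- competitor before the infimum is taken.
  refine le_iInf₂ fun v₂ g => le_iInf fun ⟨hv₂, hg, hD⟩ => ?_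
  have hvs := hv.mono_measure hle
  have hvs₂ := hv₂.mono_measure hle
  have hgs := hg.mono_measure hle
  have hDs : IsWeakGradient (shell n ρ σ) v₂ g :=
    -- For `ρ = 0` the annulus contains the origin and the shell does not; only restriction to the
    -- smaller set is needed.
    hD.mono isOpen_interior.measurableSet shell_subset_annulus
  have key : ∀ᵐ r ∂(volume.restrict (Ioo ρ σ)),
      kFunctional (sphereMeasure n r) (IsWeakTangentialGradient r) p v t
        ≤ eLpNorm (v - v₂) p (sphereMeasure n r) + ENNReal.ofReal t *
          (eLpNorm v₂ p (sphereMeasure n r) + eLpNorm g p (sphereMeasure n r)) := by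
    filter_upwards [hDs.ae_isWeakTangentialGradient hρ (hvs₂.integrable h1p) (hgs.integrable h1p),
      ae_memLp_sphereMeasure hρ hp0 hvs, ae_memLp_sphereMeasure hρ hp0 hvs₂,
      ae_memLp_sphereMeasure hρ hp0 hgs] with r h1 h2 h3 h4
    refine (kFunctional_le h2 h3 h4.tangentialPart h1 t).trans ?_
    gcongr
    exact eLpNorm_mono (norm_tangentialPart_le g)
  have m1 := aemeasurable_eLpNorm_sphereMeasure (p := p) hρ (hvs.1.sub hvs₂.1)
  have m2 := aemeasurable_eLpNorm_sphereMeasure (p := p) hρ hvs₂.1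
  have m3 := aemeasurable_eLpNorm_sphereMeasure (p := p) hρ hgs.1
  have b1 := (eLpNorm_eLpNorm_sphereMeasure_le hρ hp0 (hvs.1.sub hvs₂.1)).trans
    (eLpNorm_mono_measure _ hle)
  have b2 := (eLpNorm_eLpNorm_sphereMeasure_le hρ hp0 hvs₂.1).trans (eLpNorm_mono_measure _ hle)
  have b3 := (eLpNorm_eLpNorm_sphereMeasure_le hρ hp0 hgs.1).trans (eLpNorm_mono_measure _ hle)
  refine (eLpNorm_le_of_ae_le_add_mul_add h1p ENNReal.ofReal_ne_top m1 m2 m3 key).trans ?_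
  gcongr

/-- Exchange the two `L^q` norms, then for each `t` use Hölder in `r` to reach `L^p`, where slicing
gives the bound. This is where `q ≤ p` enters. -/
theorem exists_measurable_besovSphereENorm {p q : ℝ≥0∞} (h1p : 1 ≤ p) (hq0 : q ≠ 0) (hqp : q ≤ p)
    (hρ : 0 ≤ ρ) (s : ℝ) {v : EuclideanSpace ℝ (Fin n) → EuclideanSpace ℝ (Fin N)}
    (hv : MemLp v p (volume.restrict (annulus n ρ σ))) :
    ∃ b : ℝ → ℝ≥0∞, Measurable b ∧
      (fun r => besovSphereENorm r s p q v) =ᵐ[volume.restrict (Ioo ρ σ)] b ∧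
      eLpNorm b q (volume.restrict (Ioo ρ σ))
        ≤ ENNReal.ofReal (σ - ρ) ^ (1 / q.toReal - 1 / p.toReal)
          * besovENorm (annulus n ρ σ) s p q v := by
  have hle : volume.restrict (shell n ρ σ) ≤ volume.restrict (annulus n ρ σ) :=
    Measure.restrict_mono_set _ shell_subset_annulus
  obtain ⟨k, hk, hkv⟩ := exists_measurable_kFunctional_sphere h1p hρ (hv.mono_measure hle)
  set ν : Measure ℝ :=
    (volume.restrict (Ioi (0 : ℝ))).withDensity (fun t => ENNReal.ofReal t⁻¹) with hν
  have hνpos : ∀ᵐ t ∂ν, 0 < t :=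
    (withDensity_absolutelyContinuous _ _).ae_le (ae_restrict_mem measurableSet_Ioi)
  have hpow : Measurable fun z : ℝ × ℝ => ENNReal.ofReal (z.2 ^ (-s)) :=
    ENNReal.measurable_ofReal.comp (measurable_snd.pow_const _)
  have hf : Measurable fun z : ℝ × ℝ => ENNReal.ofReal (z.2 ^ (-s)) * k z.1 z.2 := hpow.mul hk
  refine ⟨fun r => eLpNorm (fun t => ENNReal.ofReal (t ^ (-s)) * k r t) q ν,
    measurable_eLpNorm_of_measurable_enorm q ν (by simpa only [enorm_eq_self] using hf), ?_, ?_⟩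
  · filter_upwards [hkv] with r hr
    refine eLpNorm_congr_ae ?_
    filter_upwards [hνpos] with t ht
    rw [hr t ht]
  set c : ℝ≥0∞ := ENNReal.ofReal (σ - ρ) ^ (1 / q.toReal - 1 / p.toReal) with hc
  refine (eLpNorm_eLpNorm_swap_le hq0 (volume.restrict (Ioo ρ σ)) ν hf).trans ?_
  -- `(⊤ : ℝ≥0∞).toReal = 0` and `1 / 0 = 0`, so an infinite exponent contributes `0`, as it should.
  have hexp : 0 ≤ 1 / q.toReal - 1 / p.toReal := by
    by_cases hpt : p = ⊤
    · simp [hpt]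
    · have : 0 < q.toReal := ENNReal.toReal_pos hq0 (ne_top_of_le_ne_top hpt hqp)
      exact sub_nonneg.2 (one_div_le_one_div_of_le this (ENNReal.toReal_mono hpt hqp))
  have hct : c ≠ ⊤ := ENNReal.rpow_ne_top_of_nonneg hexp ENNReal.ofReal_ne_top
  have key : ∀ᵐ t ∂ν, eLpNorm (fun r => ENNReal.ofReal (t ^ (-s)) * k r t) q
      (volume.restrict (Ioo ρ σ)) ≤ c * (ENNReal.ofReal (t ^ (-s)) *
        kFunctional (volume.restrict (annulus n ρ σ)) (IsWeakGradient (annulus n ρ σ)) p v t) := by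
    filter_upwards [hνpos] with t ht
    have hkt : Measurable fun r => k r t := hk.comp (measurable_id.prodMk measurable_const)
    have e : (fun r => k r t) =ᵐ[volume.restrict (Ioo ρ σ)]
        fun r => kFunctional (sphereMeasure n r) (IsWeakTangentialGradient r) p v t := by
      filter_upwards [hkv] with r hr using (hr t ht).symm
    calc
      _ ≤ ENNReal.ofReal (t ^ (-s)) * eLpNorm (fun r => k r t) q (volume.restrict (Ioo ρ σ)) :=
        eLpNorm_const_mul_le ENNReal.ofReal_ne_top _ q
      _ ≤ ENNReal.ofReal (t ^ (-s)) * (eLpNorm (fun r => k r t) p (volume.restrict (Ioo ρ σ)) * c) := by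
        gcongr
        have := eLpNorm_le_eLpNorm_mul_rpow_measure_univ (μ := volume.restrict (Ioo ρ σ)) hqp
          hkt.aestronglyMeasurable
        simpa only [Measure.restrict_apply_univ, Real.volume_Ioo] using this
      _ ≤ ENNReal.ofReal (t ^ (-s)) * (kFunctional (volume.restrict (annulus n ρ σ))
          (IsWeakGradient (annulus n ρ σ)) p v t * c) := by
        gcongr
        rw [eLpNorm_congr_ae e]
        exact eLpNorm_kFunctional_sphere_le h1p hρ hv ht
      _ = _ := by ring
  refine (eLpNorm_mono_enorm_ae ?_).trans (eLpNorm_const_mul_le hct _ q)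
  filter_upwards [key] with t ht using ht

end Besov

theorem lemma2p4 (s τ ρ σ : ℝ) (p q : ℝ≥0∞) (hs0 : 0 < s) (hs1 : s < 1)
    (hτ : 1 ≤ τ) (hτq : ENNReal.ofReal τ ≤ q) (hqp : q ≤ p) (hρ : 0 ≤ ρ) (hρσ : ρ < σ) :
    ∃ C : ℝ≥0, ∀ (n N : ℕ), 2 ≤ n →
      ∀ v : EuclideanSpace ℝ (Fin n) → EuclideanSpace ℝ (Fin N),
        MemBesov (annulus n ρ σ) s p q v →
          AEMeasurable (fun r : ℝ => besovSphereENorm r s p q v) (volume.restrict (Ioo ρ σ)) ∧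
          ∫⁻ r in Ioo ρ σ, besovSphereENorm r s p q v ^ τ
            ≤ (C : ℝ≥0∞) * besovENorm (annulus n ρ σ) s p q v ^ τ := by
  have hτ0 : 0 < τ := one_pos.trans_le hτ
  have h1τ : 1 ≤ ENNReal.ofReal τ := by simpa using hτ
  have h1q : 1 ≤ q := h1τ.trans hτq
  have hL0 : ENNReal.ofReal (σ - ρ) ≠ 0 := by simpa using hρσ
  -- Hölder constants on `(ρ, σ)`: `c₁` for passing from `q` to `p`, `c₂` from `τ` to `q`. Together
  -- they give `C = (σ - ρ) ^ (1 - τ / p)`, independent of `s`, `q`, `n` and `N`.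
  set c₁ := ENNReal.ofReal (σ - ρ) ^ (1 / q.toReal - 1 / p.toReal) with hc₁
  set c₂ := ENNReal.ofReal (σ - ρ) ^ (1 / τ - 1 / q.toReal) with hc₂
  have hc : (c₁ * c₂) ^ τ ≠ ⊤ := ENNReal.rpow_ne_top_of_nonneg hτ0.le (ENNReal.mul_ne_top
    (ENNReal.rpow_ne_top_of_ne_zero hL0 ENNReal.ofReal_ne_top)
    (ENNReal.rpow_ne_top_of_ne_zero hL0 ENNReal.ofReal_ne_top))
  refine ⟨((c₁ * c₂) ^ τ).toNNReal, fun n N hn v hv => ?_⟩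
  have : Nonempty (Fin n) := ⟨⟨0, by omega⟩⟩
  obtain ⟨b, hb, hbv, hbq⟩ := exists_measurable_besovSphereENorm (h1q.trans hqp)
    (one_pos.trans_le h1q).ne' hqp hρ s hv.1
  refine ⟨⟨b, hb, hbv⟩, ?_⟩
  have h1 : ∫⁻ r in Ioo ρ σ, besovSphereENorm r s p q v ^ τ
      = eLpNorm b (ENNReal.ofReal τ) (volume.restrict (Ioo ρ σ)) ^ τ := by
    rw [eLpNorm_eq_lintegral_rpow_enorm_toReal (one_pos.trans_le h1τ).ne' ENNReal.ofReal_ne_top,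
      ENNReal.toReal_ofReal hτ0.le, ← ENNReal.rpow_mul, one_div, inv_mul_cancel₀ hτ0.ne',
      ENNReal.rpow_one]
    refine lintegral_congr_ae ?_
    filter_upwards [hbv] with r hr
    rw [hr, enorm_eq_self]
  have h2 := eLpNorm_le_eLpNorm_mul_rpow_measure_univ (μ := volume.restrict (Ioo ρ σ)) hτq
    hb.aestronglyMeasurable
  rw [Measure.restrict_apply_univ, Real.volume_Ioo, ENNReal.toReal_ofReal hτ0.le, ← hc₂] at h2
  rw [h1, ENNReal.coe_toNNReal hc, ← ENNReal.mul_rpow_of_nonneg _ _ hτ0.le]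
  refine ENNReal.rpow_le_rpow (h2.trans ?_) hτ0.le
  calc _ ≤ c₁ * besovENorm (annulus n ρ σ) s p q v * c₂ := by gcongr
    _ = _ := by ring
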